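/- **Parking functions for trees and mappings.** Let $[n]=\{1,\dots,n\}$. A *road net* on $[n]$ is given either by a mapping $f:[n]\to[n]$ (with directed edges $i\to f(i)$), or by a rooted labelled unordered tree $T$ with vertex set $[n]$ (a Cayley tree), all of whose edges are directed towards the root. Drivers $1,\dots,m$ arrive one after the other; driver $k$ has a preferred node $s_k\in[n]$. He parks at $s_k$ if it is free, and otherwise follows the directed edges and parks at the first free node that he meets, if there is one. The sequence $s\in[n]^m$ is called a *parking function* for the road net if all $m$ drivers are able to park. For $0\le m\le n$ let $F_{n,m}$ be the number of pairs $(T,s)$ where $T$ is a rooted labelled tree with vertex set $[n]$ and $s\in[n]^m$ is a parking function for $T$; let $M_{n,m}$ be the number of pairs $(f,s)$ where $f:[n]\to[n]$ and $s\in[n]^m$ is a parking function for $f$; and let $C_{n,m}$ be the number of such pairs $(f,s)$ for which the functional digraph of $f$ is in addition (weakly) connected. Define the formal power series over $\mathbb{Q}$ $$\tilde F(z,u)=\sum_{n\ge1}\sum_{k=0}^{n}F_{n,n-k}\frac{z^nu^{k}}{n!\,(n-k)!},\qquad \tilde C(z,u)=\sum_{n\ge1}\sum_{k=0}^{n}C_{n,n-k}\frac{z^nu^{k}}{n!\,(n-k)!},$$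 $$\tilde M(z,u)=\sum_{n\ge0}\sum_{k=0}^{n}M_{n,n-k}\frac{z^nu^{k}}{n!\,(n-k)!}.$$ **Proposition.** There is a unique formal power series $Q=Q(z,u)\in\mathbb{Q}[[z,u]]$ with zero constant term such that $$Q=z\cdot e^{Q\,(2+u(1-Q))},$$ and with this $Q$ one has $$\tilde F(z,u)=Q\,(2+u(1-Q))+\ln(1-Q)=\ln\left(\frac{Q(1-Q)}{z}\right),$$ $$\tilde C(z,u)=\ln\left(\frac{1}{(1-Q)(1-uQ)}\right),\qquad \tilde M(z,u)=\frac{1}{(1-Q)(1-uQ)}.$$ Here $Q(1-Q)/z$ is a formal power series with constant term $1$. -/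

import Mathlib

/-- `ParksAt next occ v x`: in the road net in which a driver leaving `w` moves on to `next w`
(and has to leave the net if `next w = none`), a driver who arrives at `v` while the nodes in `occ`
are occupied ends up parking at `x`: he parks at `v` if it is free, otherwise he moves on. -/
inductive ParksAt {V : Type*} (next : V → Option V) (occ : Set V) : V → V → Prop
  | park (v : V) : v ∉ occ → ParksAt next occ v v
  | move (v w x : V) : v ∈ occ → next v = some w → ParksAt next occ w x → ParksAt next occ v x

/-- The sequence `s` of preferred parking spaces is a parking function for the road net `next`:
there is an output function `π` such that, for every `k`, driver `k` (who arrives when exactly the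
places of the earlier drivers are occupied) parks at `π k`. -/
def IsParkingFunction {V : Type*} (next : V → Option V) {m : ℕ} (s : Fin m → V) : Prop :=
  ∃ π : Fin m → V, ∀ k : Fin m, ParksAt next {x | ∃ j < k, π j = x} (s k) (π k)

/-- A Cayley tree, i.e. a rooted labelled (unordered) tree, with vertex set `V`, all edges being directed towards the
root: the root has no outgoing edge, every other node `v` has exactly one outgoing edge, to
`parent v`, and from every node there is a directed path to the root. -/
structure CayleyTree (V : Type*) where
  root : V
  parent : V → Option V
  parent_eq_none_iff : ∀ v, parent v = none ↔ v = root
  path_to_root : ∀ v, Relation.ReflTransGen (fun a b => parent a = some b) v root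

instance {V : Type*} [Finite V] : Finite (CayleyTree V) :=
  Finite.of_injective (fun T : CayleyTree V => (T.root, T.parent)) (by
    rintro ⟨r, p, _, _⟩ ⟨r', p', _, _⟩ h
    obtain ⟨rfl, rfl⟩ := Prod.mk.inj h
    rfl)

/-- The mapping `f` is connected: its functional digraph is weakly connected (and non-empty). -/
def IsConnectedMapping {V : Type*} (f : V → V) : Prop :=
  (SimpleGraph.fromRel (fun i j => f i = j)).Connected

/-- `F_{n,m}`: the number of pairs `(T, s)` of a rooted labelled tree `T` of size `n` and a parking
function `s` for `T` with `m` drivers. -/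
noncomputable def numTreeParking (n m : ℕ) : ℕ :=
  Nat.card {p : CayleyTree (Fin n) × (Fin m → Fin n) // IsParkingFunction p.1.parent p.2}

/-- `M_{n,m}`: the number of pairs `(f, s)` of an `n`-mapping `f` and a parking function `s` for
`f` with `m` drivers. -/
noncomputable def numMappingParking (n m : ℕ) : ℕ :=
  Nat.card {p : (Fin n → Fin n) × (Fin m → Fin n) //
    IsParkingFunction (fun i => some (p.1 i)) p.2}

/-- `C_{n,m}`: the same number for connected `n`-mappings. -/
noncomputable def numConnectedParking (n m : ℕ) : ℕ :=
  Nat.card {p : (Fin n → Fin n) × (Fin m → Fin n) //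
    IsConnectedMapping p.1 ∧ IsParkingFunction (fun i => some (p.1 i)) p.2}

/-- Formal power series over `ℚ` in two variables `z` (index `0`) and `u` (index `1`). -/
abbrev Series : Type := MvPowerSeries (Fin 2) ℚ

noncomputable def zVar : Series := MvPowerSeries.X 0

noncomputable def uVar : Series := MvPowerSeries.X 1

/-- The series `∑_{n ≥ n₀} ∑_{0 ≤ k ≤ n} a (n, n - k) zⁿ uᵏ / (n! (n - k)!)`, where `k` is the
number of nodes that remain empty. -/
noncomputable def parkingGF (n₀ : ℕ) (a : ℕ → ℕ → ℕ) : Series := fun d =>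
  if n₀ ≤ d 0 ∧ d 1 ≤ d 0 then
    (a (d 0) (d 0 - d 1) : ℚ) / ((d 0).factorial * (d 0 - d 1).factorial)
  else 0

/-- `F̃(z,u)`. -/
noncomputable def treeGF : Series := parkingGF 1 numTreeParking

/-- `C̃(z,u)`. -/
noncomputable def connectedGF : Series := parkingGF 1 numConnectedParking

/-- `M̃(z,u)`. -/
noncomputable def mappingGF : Series := parkingGF 0 numMappingParking

/-- `exp A`, for a series `A` with constant term `0`. -/
noncomputable def expSeries (A : Series) : Series := (PowerSeries.exp ℚ).subst A

/-- `ln A`, for a series `A` with constant term `1`: the series `log (1 + t)` at `t = A - 1`. -/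
noncomputable def lnSeries (A : Series) : Series := (PowerSeries.log ℚ).subst (A - 1)

/-! ### The derivation `z ∂/∂z` on series in `z` and `u` -/

/-! A sequence $s$ is a parking function exactly when its load vector (how many drivers prefer each
node) admits a flow of cars in which every node keeps at most one car (`isParkingFunction_iff`). The
least such flow is unique, and the edges that it uses form an acyclic net, the prime forest of the
pair (`exists_primeForest`, `PrimeForest.unique`). So parking functions on a net $h$ are counted by
the prime forests contained in $h$.

A forest with $r$ roots on $n$ nodes extends to $n^r$ mappings and to $n^{r-1}$ trees
(`card_extends_total`, `card_extends_trees_aux`). Hence $nF_{n,m}=M_{n,m}$ for $n\ge1$, that is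
$\theta\tilde F=\tilde M-1$ with $\theta=z\,\partial/\partial z$. Moreover $M_{n,\cdot}$ counts
prime forests whose trees carry one of $n$ colours. If $B$ and $E=e^B$ are the series of prime trees
and of prime forests, this says $[z^n]\tilde M=[z^n]E^n$, which is a Lagrange inversion with
$w=zE(w)$. The exponential formula gives $\tilde M=e^{\tilde C}$.

Prime trees themselves satisfy a quadratic equation. Apart from a single empty node (the term $uz$),
a prime tree on $n$ nodes holds exactly $n$ cars. Mark a car and cut the tree at the first edge on
its way to the root that is used by one car only. The upper piece is a prime tree with a marked
node, the lower one a prime tree with a marked car, and the cut is reversible (`primeTree_join`,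
`exists_join`, `IsCut.unique`). Marking a car or marking a node multiplies by the same $n$, so the
pointed series $D$ satisfies $D=z+D^2$, and $\theta B=uz+D$.

The rest is algebra (`closed_forms`). Put $Q=D(w)$, so that $w=Q(1-Q)$. Lagrange inversion gives
$\tilde F=B(w)$, $w=ze^{\tilde F}$ and $\tilde M^{-1}=1-(\theta B)(w)=(1-Q)(1-uQ)$. Integrating
$\theta B$ gives $e^B=e^{uz+2D}(1-D)$, whence the formula for $\tilde F$ and the equation for $Q$.
-/

namespace ParkingSeries

open MvPowerSeries Finsupp

/-- The derivation `z ∂/∂z`. -/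
noncomputable def theta : Derivation ℚ Series Series := zVar • pderiv ℚ (0 : Fin 2)

theorem coeff_theta (f : Series) (d : Fin 2 →₀ ℕ) :
    coeff d (theta f) = d 0 * coeff d f := by
  classical
  rw [theta, Derivation.smul_apply, smul_eq_mul, zVar, X, coeff_monomial_mul]
  split_ifs with h
  · have h1 : 1 ≤ d 0 := by simpa using h 0
    rw [coeff_pderiv, tsub_add_cancel_of_le h]
    simp only [Finsupp.tsub_apply, single_eq_same, one_mul]
    rw [Nat.cast_sub h1]
    push_cast
    ring
  · have h1 : d 0 = 0 := by
      by_contra h2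
      exact h (single_le_iff.2 (Nat.one_le_iff_ne_zero.2 h2))
    simp [h1]

theorem theta_mul (f g : Series) : theta (f * g) = theta f * g + f * theta g := by
  rw [Derivation.leibniz, smul_eq_mul, smul_eq_mul]; ring

theorem theta_zVar : theta zVar = zVar := by
  rw [theta, Derivation.smul_apply, zVar, pderiv_X_self, smul_eq_mul, mul_one]

theorem theta_uVar : theta uVar = 0 := by
  rw [theta, Derivation.smul_apply, uVar, pderiv_X_of_ne (by decide), smul_zero]

theorem zVar_dvd_iff {f : Series} : zVar ∣ f ↔ ∀ d, d 0 = 0 → coeff d f = 0 := X_dvd_iff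

theorem zVar_pow_dvd_iff {f : Series} {n : ℕ} :
    zVar ^ n ∣ f ↔ ∀ d, d 0 < n → coeff d f = 0 := X_pow_dvd_iff

theorem zVar_dvd_theta (f : Series) : zVar ∣ theta f :=
  zVar_dvd_iff.2 fun d hd => by rw [coeff_theta, hd]; simp

theorem constantCoeff_eq_zero_of_zVar_dvd {f : Series} (h : zVar ∣ f) :
    f.constantCoeff = 0 := by
  rw [← coeff_zero_eq_constantCoeff_apply]
  exact zVar_dvd_iff.1 h 0 rfl

theorem constantCoeff_eq_one_of_zVar_dvd {f : Series} (h : zVar ∣ f - 1) :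
    f.constantCoeff = 1 := by
  have := constantCoeff_eq_zero_of_zVar_dvd h
  rw [map_sub, map_one] at this
  linarith

theorem isUnit_of_zVar_dvd {f : Series} (h : zVar ∣ f - 1) : IsUnit f := by
  rw [isUnit_iff_constantCoeff, constantCoeff_eq_one_of_zVar_dvd h]
  exact isUnit_one

theorem isUnit_one_sub {f : Series} (h : zVar ∣ f) : IsUnit (1 - f) :=
  isUnit_of_zVar_dvd (by simpa using h)

/-- Series are separated in the $z$-adic topology. Several identities below are proved by showing
that their defect reproduces itself with an additional factor $z$. -/
theorem eq_zero_of_forall_pow_dvd {f : Series} (h : ∀ n, zVar ^ n ∣ f) : f = 0 := by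
  ext d
  exact zVar_pow_dvd_iff.1 (h (d 0 + 1)) d (Nat.lt_succ_self _)

/-- Uniqueness for a linear differential equation: if $z^n\mid Y$ then $z^{n+1}\mid AY=\theta Y$,
and $\theta$ multiplies each coefficient by its $z$-degree, so it loses only the part of $z$-degree
$0$, which `hY` excludes. -/
theorem eq_zero_of_theta_eq {A Y : Series} (hA : zVar ∣ A) (hY : zVar ∣ Y)
    (h : theta Y = A * Y) : Y = 0 := by
  refine eq_zero_of_forall_pow_dvd fun n => ?_
  induction n with
  | zero => simp
  | succ n ih =>
    refine zVar_pow_dvd_iff.2 fun d hd => ?_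
    have h1 : zVar ^ (n + 1) ∣ theta Y := by
      rw [h, pow_succ']
      exact mul_dvd_mul hA ih
    have h2 := zVar_pow_dvd_iff.1 h1 d hd
    rw [coeff_theta] at h2
    rcases mul_eq_zero.1 h2 with h3 | h3
    · exact zVar_dvd_iff.1 hY d (by exact_mod_cast h3)
    · exact h3

theorem eq_of_theta_eq_mul {A X Y : Series} (hA : zVar ∣ A) (h0 : zVar ∣ X - Y)
    (hX : theta X = A * X) (hY : theta Y = A * Y) : X = Y :=
  sub_eq_zero.1 (eq_zero_of_theta_eq hA h0 (by rw [map_sub, hX, hY, mul_sub]))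

theorem eq_of_theta_eq {X Y : Series} (h0 : zVar ∣ X - Y) (h : theta X = theta Y) : X = Y :=
  sub_eq_zero.1 (eq_zero_of_theta_eq (dvd_zero _) h0 (by rw [map_sub, h, sub_self, zero_mul]))

/-! ### Exponential and logarithm -/

theorem hasSubst_of_zVar_dvd {A : Series} (hA : zVar ∣ A) : PowerSeries.HasSubst A :=
  PowerSeries.HasSubst.of_constantCoeff_zero (constantCoeff_eq_zero_of_zVar_dvd hA)

theorem exists_subst_eq {A : Series} (hA : PowerSeries.HasSubst A) (f : PowerSeries ℚ) :
    ∃ g : PowerSeries ℚ, f = PowerSeries.C (PowerSeries.constantCoeff f) + PowerSeries.X * g ∧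
      f.subst A = C (PowerSeries.constantCoeff f) + A * g.subst A := by
  have hd : (PowerSeries.X : PowerSeries ℚ) ∣ f - PowerSeries.C (PowerSeries.constantCoeff f) :=
    PowerSeries.X_dvd_iff.2 (by simp)
  obtain ⟨g, hg⟩ := hd
  have hf : f = PowerSeries.C (PowerSeries.constantCoeff f) + PowerSeries.X * g := by
    rw [← hg]; ring
  refine ⟨g, hf, ?_⟩
  conv_lhs => rw [hf]
  rw [PowerSeries.subst_add hA, PowerSeries.subst_mul hA, PowerSeries.subst_X hA,
    PowerSeries.subst_C]

theorem dvd_subst_sub {A : Series} (hA : PowerSeries.HasSubst A) (f : PowerSeries ℚ) :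
    A ∣ f.subst A - C (PowerSeries.constantCoeff f) := by
  obtain ⟨g, -, hg⟩ := exists_subst_eq hA f
  rw [hg, add_sub_cancel_left]
  exact dvd_mul_right _ _

/-- The chain rule, $z$-adically: writing $f=c+Xg$, the defect for $f$ is $A$ times the defect for
$g$. -/
theorem theta_subst {A : Series} (hA : zVar ∣ A) (f : PowerSeries ℚ) :
    theta (f.subst A) = (PowerSeries.derivative ℚ f).subst A * theta A := by
  have hs := hasSubst_of_zVar_dvd hA
  have key : ∀ n, ∀ f : PowerSeries ℚ,
      zVar ^ n ∣ theta (f.subst A) - (PowerSeries.derivative ℚ f).subst A * theta A := by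
    intro n
    induction n with
    | zero => simp
    | succ n ih =>
      intro f
      obtain ⟨g, hg, hfg⟩ := exists_subst_eq hs f
      have h1 : PowerSeries.derivative ℚ f = g + PowerSeries.X * PowerSeries.derivative ℚ g := by
        conv_lhs => rw [hg]
        rw [map_add, Derivation.leibniz, PowerSeries.derivative_X, PowerSeries.derivative_C]
        simp only [smul_eq_mul]
        ring
      have h2 : theta (C (PowerSeries.constantCoeff f) : Series) = 0 := by
        rw [theta, Derivation.smul_apply, pderiv_C, smul_zero]
      have h3 : theta (f.subst A) - (PowerSeries.derivative ℚ f).subst A * theta A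
          = A * (theta (g.subst A) - (PowerSeries.derivative ℚ g).subst A * theta A) := by
        rw [hfg, map_add, h2, theta_mul, h1, PowerSeries.subst_add hs, PowerSeries.subst_mul hs,
          PowerSeries.subst_X hs]
        ring
      rw [h3, pow_succ']
      exact mul_dvd_mul hA (ih g)
  exact sub_eq_zero.1 (eq_zero_of_forall_pow_dvd fun n => key n f)

theorem zVar_dvd_expSeries_sub_one {A : Series} (hA : zVar ∣ A) : zVar ∣ expSeries A - 1 := by
  refine hA.trans ?_
  simpa [expSeries] using dvd_subst_sub (hasSubst_of_zVar_dvd hA) (PowerSeries.exp ℚ)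

theorem theta_expSeries {A : Series} (hA : zVar ∣ A) :
    theta (expSeries A) = theta A * expSeries A := by
  rw [expSeries, theta_subst hA, PowerSeries.derivative_exp, mul_comm]

/-- Exponentials are recognised by their differential equation and their value at $z=0$;
`eq_lnSeries` does the same for logarithms, so that composing `exp` with `log` is never needed. -/
theorem eq_expSeries {A Y : Series} (hA : zVar ∣ A) (hY : zVar ∣ Y - 1)
    (h : theta Y = theta A * Y) : Y = expSeries A := by
  refine eq_of_theta_eq_mul (zVar_dvd_theta A) ?_ h (theta_expSeries hA)
  have := dvd_sub hY (zVar_dvd_expSeries_sub_one hA)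
  simpa using this

theorem expSeries_add {A A' : Series} (hA : zVar ∣ A) (hA' : zVar ∣ A') :
    expSeries (A + A') = expSeries A * expSeries A' := by
  refine (eq_expSeries (dvd_add hA hA') ?_ ?_).symm
  · have h1 := zVar_dvd_expSeries_sub_one hA
    have h2 := zVar_dvd_expSeries_sub_one hA'
    have : expSeries A * expSeries A' - 1
      = (expSeries A - 1) * expSeries A' + (expSeries A' - 1) := by ring
    rw [this]
    exact dvd_add (h1.mul_right _) h2
  · rw [theta_mul, theta_expSeries hA, theta_expSeries hA', map_add]
    ring

theorem derivative_log_mul :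
    PowerSeries.derivative ℚ (PowerSeries.log ℚ) * (1 + PowerSeries.X) = 1 := by
  rw [PowerSeries.deriv_log]
  ext n
  rw [mul_add, mul_one, map_add]
  cases n with
  | zero => simp
  | succ n => simp [PowerSeries.coeff_succ_mul_X, PowerSeries.coeff_one, pow_succ]

theorem theta_lnSeries {Y : Series} (hY : zVar ∣ Y - 1) : theta (lnSeries Y) * Y = theta Y := by
  have hs := hasSubst_of_zVar_dvd hY
  have h1 := congrArg (PowerSeries.subst (Y - 1)) derivative_log_mul
  rw [PowerSeries.subst_mul hs, PowerSeries.subst_add hs, PowerSeries.subst_X hs] at h1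
  have h2 : (1 : PowerSeries ℚ).subst (Y - 1) = (1 : Series) := by
    simpa using PowerSeries.subst_C (a := Y - 1) (1 : ℚ)
  rw [h2, add_sub_cancel] at h1
  rw [lnSeries, theta_subst hY, map_sub, Derivation.map_one_eq_zero, sub_zero]
  linear_combination theta Y * h1

theorem zVar_dvd_lnSeries {Y : Series} (hY : zVar ∣ Y - 1) : zVar ∣ lnSeries Y := by
  refine hY.trans ?_
  simpa [lnSeries] using dvd_subst_sub (hasSubst_of_zVar_dvd hY) (PowerSeries.log ℚ)

theorem eq_lnSeries {A Y : Series} (hA : zVar ∣ A) (hY : zVar ∣ Y - 1)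
    (h : theta Y = theta A * Y) : A = lnSeries Y := by
  refine eq_of_theta_eq (dvd_sub hA (zVar_dvd_lnSeries hY)) ?_
  have := theta_lnSeries hY
  rw [h] at this
  exact ((isUnit_of_zVar_dvd hY).mul_right_cancel this).symm

/-- The Lipschitz property of the exponential, which makes the functional equation of $Q$ a $z$-adic
contraction. -/
theorem sub_dvd_expSeries_sub {A A' : Series} (hA : zVar ∣ A) (hA' : zVar ∣ A') :
    A - A' ∣ expSeries A - expSeries A' := by
  have h : expSeries A = expSeries A' * expSeries (A - A') := by
    rw [← expSeries_add hA' (dvd_sub hA hA'), add_sub_cancel]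
  have h1 : A - A' ∣ expSeries (A - A') - 1 := by
    simpa [expSeries] using dvd_subst_sub (hasSubst_of_zVar_dvd (dvd_sub hA hA')) (PowerSeries.exp ℚ)
  have : expSeries A - expSeries A' = expSeries A' * (expSeries (A - A') - 1) := by
    rw [h]; ring
  rw [this]
  exact h1.mul_left _

end ParkingSeries

/-! ### Lagrange inversion as a ring homomorphism -/

namespace ParkingSeries

open MvPowerSeries Finsupp

/-- The transform `H ↦ ∑ₙ zⁿ [zⁿ] (H Eⁿ)`, the coefficients being series in `u`. -/
noncomputable def diagonalTransform (E H : Series) : Series := fun d => coeff d (H * E ^ d 0)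

theorem coeff_diagonalTransform (E H : Series) (d : Fin 2 →₀ ℕ) :
    coeff d (diagonalTransform E H) = coeff d (H * E ^ d 0) := rfl

theorem diagonalTransform_add (E H K : Series) :
    diagonalTransform E (H + K) = diagonalTransform E H + diagonalTransform E K := by
  ext d
  simp only [map_add, coeff_diagonalTransform, add_mul]

/-- Shifting the index: $[z^n]\,zHE^n=[z^{n-1}]\,(HE)E^{n-1}$. -/
theorem diagonalTransform_zVar_mul (E H : Series) :
    diagonalTransform E (zVar * H) = zVar * diagonalTransform E (H * E) := by
  classical
  ext d
  rw [coeff_diagonalTransform, mul_assoc, zVar, X, coeff_monomial_mul, coeff_monomial_mul]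
  split_ifs with h
  · have h1 : d 0 ≠ 0 := Nat.one_le_iff_ne_zero.1 (by simpa using h 0)
    obtain ⟨m, hm⟩ := Nat.exists_eq_succ_of_ne_zero h1
    have h2 : (d - single 0 1 : Fin 2 →₀ ℕ) 0 = m := by simp [hm]
    rw [coeff_diagonalTransform, h2, hm, mul_assoc H E, ← pow_succ']
  · rfl

/-- The condition $\theta h=0$ means that $h$ is a series in $u$ alone; such a factor does not
change the $z$-degree, hence not the power of $E$. -/
theorem diagonalTransform_const_mul (E : Series) {h : Series} (hh : theta h = 0) (K : Series) :
    diagonalTransform E (h * K) = h * diagonalTransform E K := by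
  classical
  ext d
  rw [coeff_diagonalTransform, mul_assoc, coeff_mul, coeff_mul]
  refine Finset.sum_congr rfl fun p hp => ?_
  rw [Finset.HasAntidiagonal.mem_antidiagonal] at hp
  by_cases h0 : p.1 0 = 0
  · have : d 0 = p.2 0 := by rw [← hp, Finsupp.add_apply, h0, zero_add]
    rw [this, coeff_diagonalTransform]
  · have h1 := coeff_theta h p.1
    rw [hh, map_zero] at h1
    have h2 : coeff p.1 h = 0 := by
      rcases mul_eq_zero.1 h1.symm with h3 | h3
      · exact absurd (by exact_mod_cast h3) h0
      · exact h3
    rw [h2, zero_mul, zero_mul]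

/-- For `θ E = θ B · E`, i.e. `E = exp B`, this is `H ↦ H(w)`, where `w = z E(w)`. -/
noncomputable def lagrange (E B H : Series) : Series := diagonalTransform E (H * (1 - theta B))

theorem exists_eq_const_add_zVar_mul (H : Series) :
    ∃ h K : Series, theta h = 0 ∧ H = h + zVar * K := by
  let h : Series := fun d => if d 0 = 0 then coeff d H else 0
  have hc : ∀ d, coeff d h = if d 0 = 0 then coeff d H else 0 := fun d => rfl
  have h1 : zVar ∣ H - h := zVar_dvd_iff.2 fun d hd => by
    rw [map_sub, hc, if_pos hd, sub_self]
  obtain ⟨K, hK⟩ := h1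
  refine ⟨h, K, ?_, by rw [← hK]; ring⟩
  ext d
  rw [coeff_theta, hc]
  split_ifs with h0 <;> simp [h0]

section

variable {E B : Series}

/-- Since $\theta E^n=n\,\theta B\,E^n$, the product rule gives $n[z^n]HE^n=[z^n]\,\theta
H\,E^n+n[z^n]\,H\,\theta B\,E^n$. The factor $1-\theta B$ in `lagrange` absorbs the last term. -/
theorem theta_lagrange (hE : theta E = theta B * E) (H : Series) :
    theta (lagrange E B H) = diagonalTransform E (theta H) := by
  ext d
  have h1 : theta (H * E ^ d 0) = theta H * E ^ d 0 + (d 0 : Series) * (H * theta B * E ^ d 0) := by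
    rw [theta_mul, Derivation.leibniz_pow, hE]
    rcases Nat.eq_zero_or_pos (d 0) with h0 | h0
    · simp [h0]
    · obtain ⟨m, hm⟩ := Nat.exists_eq_succ_of_ne_zero h0.ne'
      rw [hm]
      simp only [Nat.succ_eq_add_one, Nat.add_sub_cancel, smul_eq_mul, nsmul_eq_mul, pow_succ]
      ring
  have h2 := congrArg (coeff d) h1
  rw [coeff_theta, map_add] at h2
  have h3 : coeff d ((d 0 : Series) * (H * theta B * E ^ d 0))
      = d 0 * coeff d (H * theta B * E ^ d 0) := by
    rw [← nsmul_eq_mul, map_nsmul, nsmul_eq_mul]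
  rw [h3] at h2
  rw [coeff_theta, lagrange, coeff_diagonalTransform, coeff_diagonalTransform]
  have h4 : H * (1 - theta B) * E ^ d 0 = H * E ^ d 0 - H * theta B * E ^ d 0 := by ring
  rw [h4, map_sub]
  linear_combination h2

theorem lagrange_add (H K : Series) :
    lagrange E B (H + K) = lagrange E B H + lagrange E B K := by
  rw [lagrange, add_mul, diagonalTransform_add]; rfl

/-- This encodes $w=zE(w)$ without composing series. -/
theorem lagrange_zVar_mul (H : Series) :
    lagrange E B (zVar * H) = zVar * lagrange E B (H * E) := by
  rw [lagrange, mul_assoc, diagonalTransform_zVar_mul, lagrange]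
  congr 2
  ring

theorem lagrange_const_mul {h : Series} (hh : theta h = 0) (K : Series) :
    lagrange E B (h * K) = h * lagrange E B K := by
  rw [lagrange, mul_assoc, diagonalTransform_const_mul E hh, lagrange]

theorem zVar_dvd_lagrange_sub (H : Series) : zVar ∣ lagrange E B H - H := by
  refine zVar_dvd_iff.2 fun d hd => ?_
  rw [map_sub, lagrange, coeff_diagonalTransform, hd, pow_zero, mul_one, ← map_sub]
  refine zVar_dvd_iff.1 ?_ d hd
  have : H * (1 - theta B) - H = - (H * theta B) := by ring
  rw [this]
  exact ((zVar_dvd_theta B).mul_left H).neg_right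

theorem lagrange_one (hE : theta E = theta B * E) : lagrange E B 1 = 1 := by
  refine eq_of_theta_eq (zVar_dvd_lagrange_sub 1) ?_
  rw [theta_lagrange hE, Derivation.map_one_eq_zero]
  ext d
  rw [coeff_diagonalTransform, zero_mul]

theorem lagrange_const (hE : theta E = theta B * E) {h : Series} (hh : theta h = 0) :
    lagrange E B h = h := by
  have := lagrange_const_mul (E := E) (B := B) hh 1
  rwa [lagrange_one hE, mul_one] at this

/-- Split $H=h+zH'$ with $h$ free of $z$: the defect of multiplicativity at $(H,K)$ is $z$ times the
defect at $(H'E,K)$. -/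
theorem lagrange_mul (hE : theta E = theta B * E) (H K : Series) :
    lagrange E B (H * K) = lagrange E B H * lagrange E B K := by
  have key : ∀ n, ∀ H K : Series,
      zVar ^ n ∣ lagrange E B (H * K) - lagrange E B H * lagrange E B K := by
    intro n
    induction n with
    | zero => simp
    | succ n ih =>
      intro H K
      obtain ⟨h, H', hh, rfl⟩ := exists_eq_const_add_zVar_mul H
      have h1 : lagrange E B ((h + zVar * H') * K) - lagrange E B (h + zVar * H') * lagrange E B K
          = zVar * (lagrange E B ((H' * E) * K) - lagrange E B (H' * E) * lagrange E B K) := by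
        rw [add_mul, lagrange_add, lagrange_add, lagrange_const_mul hh, lagrange_const hE hh,
          mul_assoc zVar, lagrange_zVar_mul, lagrange_zVar_mul, mul_right_comm H' K E]
        ring
      rw [h1, pow_succ']
      exact mul_dvd_mul_left _ (ih _ _)
  exact sub_eq_zero.1 (eq_zero_of_forall_pow_dvd fun n => key n H K)

/-- The diagonal transform of $H$ is `lagrange` applied to $H/(1-\theta B)$, so multiplicativity of
`lagrange` carries over. -/
theorem diagonalTransform_mul (hE : theta E = theta B * E) (H K : Series) :
    diagonalTransform E (H * K) = diagonalTransform E H * lagrange E B K := by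
  have hu : IsUnit (1 - theta B) := isUnit_one_sub (zVar_dvd_theta B)
  obtain ⟨I, hI⟩ := hu.exists_left_inv
  have h1 : ∀ H, diagonalTransform E H = lagrange E B (H * I) := fun H => by
    rw [lagrange, mul_assoc, hI, mul_one]
  rw [h1, h1, ← lagrange_mul hE]
  congr 1
  ring

/-- The equation characterising $Y=e^A$ survives the substitution $z\mapsto w$; hence `lagrange`
commutes with exponentials. -/
theorem theta_lagrange_of_theta_eq (hE : theta E = theta B * E) {A Y : Series}
    (h : theta Y = theta A * Y) :
    theta (lagrange E B Y) = theta (lagrange E B A) * lagrange E B Y := by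
  rw [theta_lagrange hE, h, diagonalTransform_mul hE, theta_lagrange hE]

theorem zVar_dvd_lagrange {H : Series} (hH : zVar ∣ H) : zVar ∣ lagrange E B H := by
  simpa using dvd_add (zVar_dvd_lagrange_sub (E := E) (B := B) H) hH

theorem zVar_dvd_lagrange_sub_one {H : Series} (hH : zVar ∣ H - 1) :
    zVar ∣ lagrange E B H - 1 := by
  simpa using dvd_add (zVar_dvd_lagrange_sub (E := E) (B := B) H) hH

end

/-! ### The functional equation of $Q$ and the closed forms -/

/-- Both exponents differ by a multiple of $P-Q$, so $P-Q=zc\,(P-Q)$ for some series $c$, and $1-zc$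
is a unit. -/
theorem eq_of_functional_equation {P Q : Series}
    (hP : P = zVar * expSeries (P * (2 + uVar * (1 - P))))
    (hQ : Q = zVar * expSeries (Q * (2 + uVar * (1 - Q)))) : P = Q := by
  have hPz : zVar ∣ P := hP ▸ dvd_mul_right _ _
  have hQz : zVar ∣ Q := hQ ▸ dvd_mul_right _ _
  have h1 := sub_dvd_expSeries_sub (hPz.mul_right (2 + uVar * (1 - P)))
    (hQz.mul_right (2 + uVar * (1 - Q)))
  have h2 : P * (2 + uVar * (1 - P)) - Q * (2 + uVar * (1 - Q))
      = (P - Q) * (2 + uVar * (1 - P - Q)) := by ring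
  rw [h2] at h1
  obtain ⟨c, hc⟩ := (dvd_mul_right _ _).trans h1
  have h3 : (1 - zVar * c) * (P - Q) = 0 := by
    have : P - Q = zVar * (expSeries (P * (2 + uVar * (1 - P)))
        - expSeries (Q * (2 + uVar * (1 - Q)))) := by
      rw [mul_sub, ← hP, ← hQ]
    rw [hc] at this
    linear_combination this
  exact sub_eq_zero.1 (((isUnit_one_sub (dvd_mul_right zVar c)).mul_right_eq_zero).1 h3)

/-- The series of the theorem, from the generating function `D` of pointed prime trees. -/
theorem closed_forms {B D E M F C : Series} (hB : zVar ∣ B) (hBD : theta B = uVar * zVar + D)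
    (hD : D = zVar + D ^ 2) (hDz : zVar ∣ D) (hE : theta E = theta B * E) (hE1 : zVar ∣ E - 1)
    (hM : M = diagonalTransform E 1) (hF : zVar ∣ F) (hFM : theta F = M - 1)
    (hC : zVar ∣ C) (hCM : theta M = theta C * M) :
    ∃ Q : Series,
      (Q.constantCoeff = 0 ∧ Q = zVar * expSeries (Q * (2 + uVar * (1 - Q)))) ∧
      (∀ P : Series, P.constantCoeff = 0 →
        P = zVar * expSeries (P * (2 + uVar * (1 - P))) → P = Q) ∧
      F = Q * (2 + uVar * (1 - Q)) + lnSeries (1 - Q) ∧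
      (∃ R : Series, zVar * R = Q * (1 - Q) ∧ R.constantCoeff = 1 ∧ F = lnSeries R) ∧
      C = lnSeries (((1 - Q) * (1 - uVar * Q))⁻¹) ∧
      M = ((1 - Q) * (1 - uVar * Q))⁻¹ := by
  set S := lagrange E B with hS
  -- Integrate $\theta F=M-1$: the transform of $1=\theta B+(1-\theta B)$ is $M=\theta(SB)+1$.
  have hFS : S B = F := by
    refine eq_of_theta_eq (dvd_sub (zVar_dvd_lagrange hB) hF) ?_
    have h1 : diagonalTransform E (theta B) + lagrange E B 1 = diagonalTransform E 1 := by
      rw [lagrange, ← diagonalTransform_add]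
      congr 1
      ring
    rw [hS, theta_lagrange hE, hFM, hM, ← h1, lagrange_one hE, add_sub_cancel_right]
  have hSE : S E = expSeries F := by
    rw [← hFS]
    exact eq_expSeries (zVar_dvd_lagrange hB) (zVar_dvd_lagrange_sub_one hE1)
      (theta_lagrange_of_theta_eq hE hE)
  set w := S zVar with hw
  have hwF : w = zVar * expSeries F := by
    have := lagrange_zVar_mul (E := E) (B := B) 1
    rw [mul_one, one_mul] at this
    rw [hw, hS, this, ← hS, hSE]
  set Q := S D with hQ
  have hQz : zVar ∣ Q := zVar_dvd_lagrange hDz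
  have hQw : w = Q * (1 - Q) := by
    have h1 : S D = S zVar + S D * S D := by
      conv_lhs => rw [hD]
      rw [hS, lagrange_add, pow_two, lagrange_mul hE]
    rw [hw]
    linear_combination - h1
  have hSu : S (uVar * zVar) = uVar * w := lagrange_const_mul theta_uVar _
  have hQ1 : IsUnit (1 - Q) := isUnit_one_sub hQz
  -- the mappings
  have hMQ : M * ((1 - Q) * (1 - uVar * Q)) = 1 := by
    -- Here $1=S(1)=M\cdot S(1-\theta B)$, and $S(1-\theta B)=1-uw-Q$ factors because $w=Q(1-Q)$.
    have h1 : diagonalTransform E ((1 : Series) * (1 - theta B)) = M * S (1 - theta B) := by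
      rw [hM, diagonalTransform_mul hE]
    have h2 : S (1 - theta B) + S (theta B) = 1 := by
      rw [hS, ← lagrange_add, sub_add_cancel, lagrange_one hE]
    have h3 : S (theta B) = uVar * w + Q := by
      rw [hBD, hS, lagrange_add, ← hS, hSu]
    have h4 : diagonalTransform E ((1 : Series) * (1 - theta B)) = 1 := lagrange_one hE
    rw [h4] at h1
    have h5 : S (1 - theta B) = (1 - Q) * (1 - uVar * Q) := by
      rw [h3, hQw] at h2
      linear_combination h2
    rw [← h5]
    exact h1.symm
  -- the exponential of the trees
  set phi := Q * (2 + uVar * (1 - Q)) with hphi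
  have hphiz : zVar ∣ phi := hQz.mul_right _
  have hA0 : zVar ∣ uVar * zVar + 2 * D := dvd_add (dvd_mul_left _ _) (hDz.mul_left _)
  -- The explicit integral $B=uz+2D+\ln(1-D)$ of $\theta B=uz+D$: from $D=z+D^2$ one has
  -- $(1-2D)\,\theta D=z=D(1-D)$.
  have hEexp : E = expSeries (uVar * zVar + 2 * D) * (1 - D) := by
    have h1 := zVar_dvd_expSeries_sub_one hA0
    refine eq_of_theta_eq_mul (zVar_dvd_theta B) ?_ hE ?_
    · have : E - expSeries (uVar * zVar + 2 * D) * (1 - D)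
        = (E - 1) - (expSeries (uVar * zVar + 2 * D) - 1) * (1 - D) + D := by ring
      rw [this]
      exact dvd_add (dvd_sub hE1 (h1.mul_right _)) hDz
    · have h2 : theta D = zVar + 2 * D * theta D := by
        conv_lhs => rw [hD]
        rw [map_add, theta_zVar, pow_two, theta_mul]
        ring
      have h3 : theta (2 : Series) = 0 := by
        have := theta.map_natCast 2
        simpa using this
      rw [theta_mul, theta_expSeries hA0, map_sub, Derivation.map_one_eq_zero, map_add, theta_mul,
        theta_mul, theta_uVar, theta_zVar, h3, hBD]
      linear_combination expSeries (uVar * zVar + 2 * D) * (h2 - hD)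
  have hFexp : expSeries F = expSeries phi * (1 - Q) := by
    have h1 : S (expSeries (uVar * zVar + 2 * D)) = expSeries phi := by
      have h2 : S (uVar * zVar + 2 * D) = phi := by
        rw [two_mul, hS, lagrange_add, lagrange_add, ← hS, hSu, hQw, hphi]
        ring
      rw [← h2]
      exact eq_expSeries (zVar_dvd_lagrange hA0)
        (zVar_dvd_lagrange_sub_one (zVar_dvd_expSeries_sub_one hA0))
        (theta_lagrange_of_theta_eq hE (theta_expSeries hA0))
    have h2 : S (1 - D) + S D = 1 := by
      rw [hS, ← lagrange_add, sub_add_cancel, lagrange_one hE]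
    rw [← hSE, hEexp, hS, lagrange_mul hE, ← hS, h1, eq_sub_iff_add_eq.2 h2]
  -- Compare $w=Q(1-Q)$ with $w=ze^{F}=ze^{\varphi}(1-Q)$ and cancel $1-Q$.
  have hQeq : Q = zVar * expSeries phi := by
    refine hQ1.mul_right_cancel ?_
    rw [← hQw, hwF, hFexp]
    ring
  have hQ0 := constantCoeff_eq_zero_of_zVar_dvd hQz
  have hF1 := zVar_dvd_expSeries_sub_one hF
  have hMinv : M = ((1 - Q) * (1 - uVar * Q))⁻¹ := by
    rw [MvPowerSeries.eq_inv_iff_mul_eq_one]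
    · exact hMQ
    · simp [hQ0]
  have hM1 : zVar ∣ M - 1 := hFM ▸ zVar_dvd_theta F
  refine ⟨Q, ⟨hQ0, hQeq⟩, fun P _ hP => eq_of_functional_equation hP hQeq, ?_,
    ⟨expSeries F, ?_, constantCoeff_eq_one_of_zVar_dvd hF1,
      eq_lnSeries hF hF1 (theta_expSeries hF)⟩, ?_, hMinv⟩
  · rw [← sub_eq_iff_eq_add']
    refine eq_lnSeries (dvd_sub hF hphiz) (by simpa using hQz.neg_right) ?_
    have h1 := theta_expSeries hF
    rw [hFexp, theta_mul, theta_expSeries hphiz] at h1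
    have h2 : IsUnit (expSeries phi) := isUnit_of_zVar_dvd (zVar_dvd_expSeries_sub_one hphiz)
    refine h2.mul_left_cancel ?_
    rw [map_sub theta F phi]
    linear_combination h1
  · rw [← hwF, hQw]
  · rw [← hMinv]
    exact eq_lnSeries hC hM1 hCM

end ParkingSeries

/-! ### Exponential generating functions with polynomial coefficients in `u` -/

namespace ParkingSeries

open MvPowerSeries Finsupp

/-- The series `∑ₙ hₙ(u) zⁿ / n!`. -/
noncomputable def egf (h : ℕ → Polynomial ℚ) : Series :=
  fun d => (h (d 0)).coeff (d 1) / (d 0).factorial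

theorem coeff_egf (h : ℕ → Polynomial ℚ) (d : Fin 2 →₀ ℕ) :
    coeff d (egf h) = (h (d 0)).coeff (d 1) / (d 0).factorial := rfl

theorem theta_egf (h : ℕ → Polynomial ℚ) : theta (egf h) = egf fun n => n * h n := by
  ext d
  rw [coeff_theta, coeff_egf, coeff_egf, Polynomial.coeff_natCast_mul, mul_div_assoc]

theorem zVar_dvd_egf {h : ℕ → Polynomial ℚ} (h0 : h 0 = 0) : zVar ∣ egf h :=
  zVar_dvd_iff.2 fun d hd => by rw [coeff_egf, hd, h0]; simp

theorem zVar_dvd_egf_sub_one {h : ℕ → Polynomial ℚ} (h0 : h 0 = 1) : zVar ∣ egf h - 1 := by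
  classical
  refine zVar_dvd_iff.2 fun d hd => ?_
  rw [map_sub, coeff_egf, hd, h0, Polynomial.coeff_one, coeff_one]
  by_cases h1 : d 1 = 0
  · have : d = 0 := by
      ext i
      fin_cases i
      · exact hd
      · exact h1
    simp [this]
  · have : d ≠ 0 := fun h2 => h1 (by simp [h2])
    simp [this, h1]

theorem sum_antidiagonal_fin_two {R : Type*} [AddCommMonoid R] (d : Fin 2 →₀ ℕ)
    (F : ℕ × ℕ → ℕ × ℕ → R) :
    ∑ p ∈ Finset.HasAntidiagonal.antidiagonal d, F (p.1 0, p.2 0) (p.1 1, p.2 1)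
      = ∑ i ∈ Finset.HasAntidiagonal.antidiagonal (d 0), ∑ k ∈ Finset.HasAntidiagonal.antidiagonal (d 1), F i k := by
  rw [← Finset.sum_product']
  refine Finset.sum_nbij' (fun p => ((p.1 0, p.2 0), (p.1 1, p.2 1)))
    (fun q => (single 0 q.1.1 + single 1 q.2.1, single 0 q.1.2 + single 1 q.2.2))
    ?_ ?_ ?_ ?_ ?_
  · intro p hp
    rw [Finset.HasAntidiagonal.mem_antidiagonal] at hp
    simp [← hp]
  · intro q hq
    rw [Finset.mem_product, Finset.HasAntidiagonal.mem_antidiagonal,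
      Finset.HasAntidiagonal.mem_antidiagonal] at hq
    rw [Finset.HasAntidiagonal.mem_antidiagonal]
    ext i
    fin_cases i
    · simpa using hq.1
    · simpa using hq.2
  · intro p _
    refine Prod.ext ?_ ?_ <;> ext i <;> fin_cases i <;> simp
  · intro q _
    simp
  · intro p _
    rfl

/-- The summand depends only on the size of $A$, so the sum over subsets is a binomial convolution;
the factorials in both series turn it into a product. -/
theorem egf_eq_mul {χ φ ψ : ℕ → Polynomial ℚ}
    (h : ∀ n, χ n = ∑ A : Finset (Fin n), φ A.card * ψ (n - A.card)) :
    egf χ = egf φ * egf ψ := by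
  classical
  ext d
  have h1 : χ (d 0) = ∑ i ∈ Finset.HasAntidiagonal.antidiagonal (d 0),
      (d 0).choose i.1 • (φ i.1 * ψ i.2) := by
    rw [h, Finset.Nat.sum_antidiagonal_eq_sum_range_succ_mk]
    have := Finset.sum_powerset_apply_card (fun i => φ i * ψ (d 0 - i))
      (x := (Finset.univ : Finset (Fin (d 0))))
    rwa [Finset.powerset_univ, Finset.card_univ, Fintype.card_fin] at this
  rw [coeff_mul, coeff_egf, h1, Polynomial.finsetSum_coeff, Finset.sum_div]
  simp only [coeff_egf]
  rw [sum_antidiagonal_fin_two d fun i k => (φ i.1).coeff k.1 / (i.1.factorial : ℚ)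
    * ((ψ i.2).coeff k.2 / (i.2.factorial : ℚ))]
  refine Finset.sum_congr rfl fun i hi => ?_
  rw [Finset.HasAntidiagonal.mem_antidiagonal] at hi
  rw [Polynomial.coeff_smul, Polynomial.coeff_mul, nsmul_eq_mul, Finset.mul_sum, Finset.sum_div]
  refine Finset.sum_congr rfl fun k _ => ?_
  have h2 : ((d 0).choose i.1 : ℚ) * i.1.factorial * i.2.factorial = (d 0).factorial := by
    rw [← hi, Nat.choose_symm_add]
    exact_mod_cast Nat.add_choose_mul_factorial_mul_factorial i.1 i.2
  have h3 : (i.1.factorial : ℚ) ≠ 0 := by exact_mod_cast i.1.factorial_ne_zero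
  have h4 : (i.2.factorial : ℚ) ≠ 0 := by exact_mod_cast i.2.factorial_ne_zero
  have h5 : ((d 0).factorial : ℚ) ≠ 0 := by exact_mod_cast (d 0).factorial_ne_zero
  field_simp
  rw [← h2]
  ring

end ParkingSeries

/-! ### Road nets, disjoint unions and connected components -/

namespace RoadNet

open Finset

/-- The disjoint union of two road nets. -/
def glue {A B V : Type} (e : A ⊕ B ≃ V) (g₁ : A → Option A) (g₂ : B → Option B) (v : V) :
    Option V :=
  Sum.elim (fun a => (g₁ a).map fun a' => e (Sum.inl a'))
    (fun b => (g₂ b).map fun b' => e (Sum.inr b')) (e.symm v)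

section Glue

variable {A B V : Type} (e : A ⊕ B ≃ V) (g₁ : A → Option A) (g₂ : B → Option B)

@[simp] theorem glue_inl (a : A) :
    glue e g₁ g₂ (e (Sum.inl a)) = (g₁ a).map fun a' => e (Sum.inl a') := by simp [glue]

@[simp] theorem glue_inr (b : B) :
    glue e g₁ g₂ (e (Sum.inr b)) = (g₂ b).map fun b' => e (Sum.inr b') := by simp [glue]

theorem forall_equiv_sum {e : A ⊕ B ≃ V} {p : V → Prop} :
    (∀ v, p v) ↔ (∀ a, p (e (Sum.inl a))) ∧ ∀ b, p (e (Sum.inr b)) := by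
  rw [← e.forall_congr_right, Sum.forall]

theorem glue_injective {g₁ g₁' : A → Option A} {g₂ g₂' : B → Option B}
    (h : glue e g₁ g₂ = glue e g₁' g₂') : g₁ = g₁' ∧ g₂ = g₂' := by
  constructor
  · funext a
    have := congrFun h (e (Sum.inl a))
    rw [glue_inl, glue_inl] at this
    exact Option.map_injective (fun _ _ h => Sum.inl_injective (e.injective h)) this
  · funext b
    have := congrFun h (e (Sum.inr b))
    rw [glue_inr, glue_inr] at this
    exact Option.map_injective (fun _ _ h => Sum.inr_injective (e.injective h)) this

end Glue

/-- `Z` is a union of connected components. -/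
def Invariant {V : Type} (g : V → Option V) (Z : Set V) : Prop :=
  ∀ v w, g v = some w → (v ∈ Z ↔ w ∈ Z)

/-- The net is non-empty and weakly connected. -/
def IsConnected {V : Type} (g : V → Option V) : Prop :=
  Nonempty V ∧ ∀ Z : Set V, Invariant g Z → Z.Nonempty → ∀ v, v ∈ Z

theorem Invariant.compl {V : Type} {g : V → Option V} {Z : Set V} (h : Invariant g Z) :
    Invariant g Zᶜ := fun v w hvw => not_congr (h v w hvw)

theorem invariant_glue {A B V : Type} {e : A ⊕ B ≃ V} {g₁ : A → Option A} {g₂ : B → Option B}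
    {Z : Set V} :
    Invariant (glue e g₁ g₂) Z ↔
      Invariant g₁ {a | e (Sum.inl a) ∈ Z} ∧ Invariant g₂ {b | e (Sum.inr b) ∈ Z} := by
  constructor
  · intro h
    exact ⟨fun a a' ha => h _ _ (by rw [glue_inl, ha]; rfl),
      fun b b' hb => h _ _ (by rw [glue_inr, hb]; rfl)⟩
  · rintro ⟨h1, h2⟩ v w hvw
    obtain ⟨x, rfl⟩ := e.surjective v
    rcases x with a | b
    · rw [glue_inl, Option.map_eq_some_iff] at hvw
      obtain ⟨a', ha', rfl⟩ := hvw
      exact h1 a a' ha'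
    · rw [glue_inr, Option.map_eq_some_iff] at hvw
      obtain ⟨b', hb', rfl⟩ := hvw
      exact h2 b b' hb'

theorem exists_glue {A B V : Type} (e : A ⊕ B ≃ V) {g : V → Option V}
    (h : Invariant g {v | ∃ a, e (Sum.inl a) = v}) :
    ∃ g₁ g₂, glue e g₁ g₂ = g := by
  have h1 : ∀ a, ∃ o : Option A, (o.map fun a' => e (Sum.inl a')) = g (e (Sum.inl a)) := by
    intro a
    cases hg : g (e (Sum.inl a)) with
    | none => exact ⟨none, rfl⟩
    | some w =>
      obtain ⟨a', rfl⟩ := (h _ _ hg).1 ⟨a, rfl⟩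
      exact ⟨some a', rfl⟩
  have h2 : ∀ b, ∃ o : Option B, (o.map fun b' => e (Sum.inr b')) = g (e (Sum.inr b)) := by
    intro b
    cases hg : g (e (Sum.inr b)) with
    | none => exact ⟨none, rfl⟩
    | some w =>
      obtain ⟨x, rfl⟩ := e.surjective w
      rcases x with a | b'
      · obtain ⟨a', ha'⟩ := (h _ _ hg).2 ⟨a, rfl⟩
        exact absurd (e.injective ha') (by simp)
      · exact ⟨some b', rfl⟩
  choose g₁ hg₁ using h1
  choose g₂ hg₂ using h2
  refine ⟨g₁, g₂, funext fun v => ?_⟩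
  obtain ⟨x, rfl⟩ := e.surjective v
  rcases x with a | b
  · rw [glue_inl, hg₁]
  · rw [glue_inr, hg₂]

theorem invariant_empty {V : Type} (g : V → Option V) : Invariant g ∅ := fun _ _ _ => Iff.rfl

theorem invariant_univ {V : Type} (g : V → Option V) : Invariant g Set.univ :=
  fun _ _ _ => Iff.rfl

/-- Used to recognise, inside a glued net, when the component of a given node is exactly the first
part. -/
theorem isConnected_iff_component_glue {A B V : Type} (e : A ⊕ B ≃ V) (g₁ : A → Option A)
    (g₂ : B → Option B) (a₀ : A) :
    IsConnected g₁ ↔ ∀ w, (∀ Z, Invariant (glue e g₁ g₂) Z → e (Sum.inl a₀) ∈ Z → w ∈ Z) ↔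
      ∃ a, e (Sum.inl a) = w := by
  constructor
  · rintro ⟨-, h⟩ w
    constructor
    · intro hw
      refine hw {v | ∃ a, e (Sum.inl a) = v} (invariant_glue.2 ⟨?_, ?_⟩) ⟨a₀, rfl⟩
      · convert invariant_univ g₁
        ext a
        simp
      · convert invariant_empty g₂
        ext b
        simp
    · rintro ⟨a, rfl⟩ Z hZ h0
      exact h _ (invariant_glue.1 hZ).1 ⟨a₀, h0⟩ a
  · intro h
    refine ⟨⟨a₀⟩, ?_⟩
    have key : ∀ Z, Invariant g₁ Z → a₀ ∈ Z → ∀ a, a ∈ Z := by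
      intro Z hZ h0 a
      have h1 : Invariant (glue e g₁ g₂) {v | ∃ a ∈ Z, e (Sum.inl a) = v} := by
        refine invariant_glue.2 ⟨?_, ?_⟩
        · convert hZ
          ext a
          simp
        · convert invariant_empty g₂
          ext b
          simp
      obtain ⟨a', ha', h2⟩ := (h (e (Sum.inl a))).2 ⟨a, rfl⟩ _ h1 ⟨a₀, h0, rfl⟩
      rwa [← Sum.inl_injective (e.injective h2)]
    rintro Z hZ ⟨z, hz⟩
    -- Only sets through $a_0$ are controlled; otherwise pass to the complement, which is invariant
    -- as well.
    by_cases h0 : a₀ ∈ Z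
    · exact key Z hZ h0
    · exact absurd hz (key Zᶜ hZ.compl h0 z)

/-- The component of `v₀`. -/
noncomputable def component {V : Type} [Fintype V] (g : V → Option V) (v₀ : V) : Finset V :=
  open Classical in univ.filter fun w => ∀ Z, Invariant g Z → v₀ ∈ Z → w ∈ Z

theorem mem_component {V : Type} [Fintype V] {g : V → Option V} {v₀ w : V} :
    w ∈ component g v₀ ↔ ∀ Z, Invariant g Z → v₀ ∈ Z → w ∈ Z := by
  simp [component]

theorem invariant_component {V : Type} [Fintype V] (g : V → Option V) (v₀ : V) :
    Invariant g {w | w ∈ component g v₀} := by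
  intro v w hvw
  simp only [Set.mem_ofPred_eq, mem_component]
  exact forall_congr' fun Z => forall_congr' fun hZ => forall_congr' fun _ => hZ v w hvw

/-- A family of weights of road nets that is multiplicative for disjoint unions. -/
structure IsMultiplicative {R : Type} [CommRing R]
    (ω : ∀ {V : Type} [Fintype V], (V → Option V) → R) : Prop where
  glue : ∀ {A B V : Type} [Fintype A] [Fintype B] [Fintype V] (e : A ⊕ B ≃ V)
    (g₁ : A → Option A) (g₂ : B → Option B), ω (glue e g₁ g₂) = ω g₁ * ω g₂
  empty : ∀ {V : Type} [Fintype V] [IsEmpty V] (g : V → Option V), ω g = 1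

section Weights

variable {R : Type} [CommRing R] (ω : ∀ {V : Type} [Fintype V], (V → Option V) → R)

/-- The total weight of the road nets on `V`. -/
noncomputable def total (V : Type) [Fintype V] : R :=
  open Classical in ∑ g : V → Option V, ω g

/-- The total weight of the connected road nets on `V`. -/
noncomputable def totalConnected (V : Type) [Fintype V] : R :=
  open Classical in ∑ g : V → Option V with IsConnected g, ω g

variable {ω} (hω : IsMultiplicative (R := R) ω)
include hω

/-- Invariance under relabelling is not part of `IsMultiplicative`; it follows by gluing with the
empty net along $V\simeq A\sqcup\emptyset$. -/
theorem total_sum_equiv {A V : Type} [Fintype A] [Fintype V] (e : A ≃ V) :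
    total ω A = total ω V ∧ totalConnected ω A = totalConnected ω V := by
  classical
  let e' : A ⊕ Empty ≃ V := (Equiv.sumEmpty A Empty).trans e
  let f : (A → Option A) → (V → Option V) := fun g => glue e' g Empty.elim
  have hf : Function.Bijective f := by
    constructor
    · intro g g' h
      exact (glue_injective e' h).1
    · intro g
      have h1 : Invariant g {v | ∃ a, e' (Sum.inl a) = v} := by
        convert invariant_univ g
        ext v
        simpa [e'] using e.surjective v
      obtain ⟨g₁, g₂, h⟩ := exists_glue e' h1
      exact ⟨g₁, by rw [← h]; congr 1⟩
  have hw : ∀ g, ω (f g) = ω g := fun g => by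
    rw [hω.glue, hω.empty (Empty.elim : Empty → Option Empty), mul_one]
  have hc : ∀ g, IsConnected (f g) ↔ IsConnected g := by
    intro g
    constructor
    · rintro ⟨⟨v⟩, h⟩
      refine ⟨⟨e.symm v⟩, fun Z hZ hne a => ?_⟩
      have := h {v | e.symm v ∈ Z} (invariant_glue.2 ⟨by simpa [e'] using hZ, nofun⟩)
        ⟨e hne.some, by simpa using hne.some_mem⟩ (e a)
      simpa using this
    · rintro ⟨⟨a⟩, h⟩
      refine ⟨⟨e a⟩, fun Z hZ hne v => ?_⟩
      have := h {a | e a ∈ Z} (by simpa [e'] using (invariant_glue.1 hZ).1)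
        ⟨e.symm hne.some, by simpa using hne.some_mem⟩ (e.symm v)
      simpa using this
  constructor
  · exact Fintype.sum_bijective f hf _ _ fun g => (hw g).symm
  · rw [totalConnected, totalConnected]
    refine Finset.sum_bijective f hf (fun g => ?_) fun g _ => (hw g).symm
    simp [hc]

theorem total_eq_card (V : Type) [Fintype V] : total ω V = total ω (Fin (Fintype.card V)) :=
  (total_sum_equiv hω (Fintype.equivFin V)).1

theorem totalConnected_eq_card (V : Type) [Fintype V] :
    totalConnected ω V = totalConnected ω (Fin (Fintype.card V)) :=
  (total_sum_equiv hω (Fintype.equivFin V)).2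

/-- A net in which $A$ is the component of $v_0$ is a connected net on $A$ glued to an arbitrary net
on the complement. -/
theorem sum_component_eq {V : Type} [Fintype V] [DecidableEq V] (v₀ : V) (A : Finset V)
    (h0 : v₀ ∈ A) :
    ∑ g : V → Option V with component g v₀ = A, ω g
      = totalConnected ω {v // v ∈ A} * total ω {v // v ∉ A} := by
  classical
  rw [totalConnected, total, sum_mul_sum, ← sum_product']
  symm
  let e : {v // v ∈ A} ⊕ {v // v ∉ A} ≃ V := Equiv.sumCompl (· ∈ A)
  have hr : ∀ w, (∃ a, e (Sum.inl a) = w) ↔ w ∈ A := fun w =>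
    ⟨by rintro ⟨a, rfl⟩; simp [e], fun hw => ⟨⟨w, hw⟩, rfl⟩⟩
  have hconn : ∀ g₁ g₂, component (glue e g₁ g₂) v₀ = A ↔ IsConnected g₁ := by
    intro g₁ g₂
    rw [isConnected_iff_component_glue e g₁ g₂ ⟨v₀, h0⟩, Finset.ext_iff]
    exact forall_congr' fun w => by rw [mem_component, hr]; rfl
  refine sum_nbij (fun p => glue e p.1 p.2) ?_ ?_ ?_ ?_
  · intro p hp
    simp only [mem_product, mem_filter_univ, mem_univ, and_true] at hp ⊢
    exact (hconn _ _).2 hp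
  · intro p _ q _ hpq
    exact Prod.ext (glue_injective e hpq).1 (glue_injective e hpq).2
  · intro g hg
    simp only [coe_filter, mem_univ, true_and, Set.mem_ofPred_eq] at hg
    have h1 : Invariant g {v | ∃ a, e (Sum.inl a) = v} := by
      have := invariant_component g v₀
      rw [hg] at this
      convert this using 3
      exact hr _
    obtain ⟨g₁, g₂, rfl⟩ := exists_glue e h1
    exact ⟨(g₁, g₂), by simpa using (hconn _ _).1 hg, rfl⟩
  · intro p _
    rw [hω.glue]

/-- Choose a distinguished node and sort the nets by its component $A$; the $|A|$ possible choices
within $A$ give the extra factor. -/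
theorem card_mul_total (n : ℕ) :
    (n : R) * total ω (Fin n) = ∑ A : Finset (Fin n),
      (A.card : R) * totalConnected ω (Fin A.card) * total ω (Fin (n - A.card)) := by
  classical
  have h1 : ∀ v : Fin n, total ω (Fin n) = ∑ A : Finset (Fin n),
      if v ∈ A then totalConnected ω (Fin A.card) * total ω (Fin (n - A.card)) else 0 := by
    intro v
    rw [total, ← sum_fiberwise_of_maps_to (t := univ) (g := fun g => component g v)
      (fun _ _ => mem_univ _)]
    refine sum_congr rfl fun A _ => ?_
    split_ifs with hv
    · refine Eq.trans (by congr!) ((sum_component_eq hω v A hv).trans ?_)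
      rw [totalConnected_eq_card hω, total_eq_card hω {x // x ∉ A}]
      have h2 : Fintype.card {x // x ∈ A} = A.card := Fintype.card_coe A
      have h3 : Fintype.card {x // x ∉ A} = n - A.card := by
        rw [Fintype.card_subtype_compl, Fintype.card_fin, Fintype.card_coe]
      rw [h2, h3]
    · refine sum_eq_zero fun g hg => ?_
      simp only [mem_filter_univ] at hg
      exact absurd (hg ▸ mem_component.2 fun _ _ h => h) hv
  have h2 : (n : R) * total ω (Fin n) = ∑ v : Fin n, total ω (Fin n) := by simp
  rw [h2, sum_congr rfl fun v _ => h1 v, sum_comm]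
  refine sum_congr rfl fun A _ => ?_
  rw [sum_ite_mem, univ_inter, sum_const, nsmul_eq_mul, mul_assoc]

end Weights

/-- The exponential formula, in differential form. -/
theorem theta_egf_total {ω : ∀ {V : Type} [Fintype V], (V → Option V) → Polynomial ℚ}
    (hω : IsMultiplicative ω) :
    ParkingSeries.theta (ParkingSeries.egf fun n => total ω (Fin n))
      = ParkingSeries.theta (ParkingSeries.egf fun n => totalConnected ω (Fin n))
        * ParkingSeries.egf fun n => total ω (Fin n) := by
  rw [ParkingSeries.theta_egf, ParkingSeries.theta_egf]
  exact ParkingSeries.egf_eq_mul fun n => card_mul_total hω n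

end RoadNet

/-! ### Flows of cars and parking functions -/

namespace RoadNet

open Finset

/-- The number of drivers who prefer `v`. -/
def load {V : Type} [DecidableEq V] {m : ℕ} (s : Fin m → V) (v : V) : ℕ :=
  ∑ k, if s k = v then 1 else 0

/-- The number of cars coming from the predecessors of `v`, if `x w` cars leave `w`. -/
noncomputable def inflow {V : Type} [Fintype V] (g : V → Option V) (x : V → ℕ) (v : V) : ℕ :=
  open Classical in ∑ w, if g w = some v then x w else 0

/-- The cars can flow through the net in such a way that no node has to keep two of them. -/
def Parkable {V : Type} [Fintype V] (g : V → Option V) (c : V → ℕ) : Prop :=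
  ∃ x : V → ℕ, (∀ v, g v = none → x v = 0) ∧ ∀ v, c v + inflow g x v ≤ x v + 1

section Flow

variable {V : Type} [Fintype V] (g : V → Option V)

theorem inflow_add (x y : V → ℕ) (v : V) : inflow g (x + y) v = inflow g x v + inflow g y v := by
  rw [inflow, inflow, inflow, ← sum_add_distrib]
  refine sum_congr rfl fun w _ => ?_
  split_ifs <;> simp

theorem inflow_zero (v : V) : inflow g 0 v = 0 := by simp [inflow]

theorem inflow_mono {x y : V → ℕ} (h : x ≤ y) (v : V) : inflow g x v ≤ inflow g y v :=
  sum_le_sum fun w _ => by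
    split_ifs
    · exact h w
    · exact le_rfl

theorem le_inflow {x : V → ℕ} {v w : V} (h : g w = some v) : x w ≤ inflow g x v := by
  classical
  have := single_le_sum (f := fun w => if g w = some v then x w else 0) (fun _ _ => Nat.zero_le _)
    (mem_univ w)
  simpa [h, inflow] using this

theorem inflow_sum {ι : Type} (s : Finset ι) (y : ι → V → ℕ) (v : V) :
    inflow g (∑ k ∈ s, y k) v = ∑ k ∈ s, inflow g (y k) v := by
  classical
  induction s using Finset.induction_on with
  | empty => simp [inflow]
  | insert k s hk ih => rw [sum_insert hk, sum_insert hk, inflow_add, ih]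

variable [DecidableEq V]

theorem inflow_single (v w : V) :
    inflow g (Pi.single v 1) w = if g v = some w then 1 else 0 := by
  rw [inflow, sum_eq_single v]
  · simp
  · intro b _ hb
    simp [hb]
  · simp

theorem inflow_single_of_eq {v u : V} (h : g v = some u) (w : V) :
    inflow g (Pi.single v 1) w = (Pi.single u 1 : V → ℕ) w := by
  rw [inflow_single, h, Pi.single_apply]
  simp [eq_comm]

theorem sum_inflow (x : V → ℕ) (hx : ∀ v, g v = none → x v = 0) :
    ∑ v, inflow g x v = ∑ v, x v := by
  classical
  simp only [inflow]
  rw [sum_comm]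
  refine sum_congr rfl fun w _ => ?_
  cases hw : g w with
  | none => simp [hx w hw]
  | some u => simp

end Flow

/-- The route of one driver is a unit flow from his preferred node to the place where he parks. -/
theorem exists_flow_of_parksAt {V : Type} [Fintype V] [DecidableEq V] {g : V → Option V}
    {occ : Set V} {v p : V} (h : ParksAt g occ v p) :
    p ∉ occ ∧ ∃ y : V → ℕ, (∀ w, g w = none → y w = 0) ∧
      ∀ w, (Pi.single v 1 : V → ℕ) w + inflow g y w = y w + (Pi.single p 1 : V → ℕ) w := by
  induction h with
  | park v hv => exact ⟨hv, 0, by simp, by simp [inflow_zero]⟩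
  | move v w x hv hvw _ ih =>
    obtain ⟨hx, y, hy0, hy⟩ := ih
    refine ⟨hx, y + Pi.single v 1, fun u hu => ?_, fun u => ?_⟩
    · have : u ≠ v := by
        rintro rfl
        rw [hu] at hvw
        exact absurd hvw (by simp)
      simp [hy0 u hu, this]
    · rw [inflow_add, inflow_single_of_eq g hvw, Pi.add_apply]
      have := hy u
      omega

theorem load_eq_sum_single {V : Type} [DecidableEq V] {m : ℕ} (s : Fin m → V) (v : V) :
    load s v = ∑ k, (Pi.single (s k) 1 : V → ℕ) v := by
  simp only [load, Pi.single_apply]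
  exact sum_congr rfl fun k _ => by simp [eq_comm]

/-- Superpose the routes of all drivers. Nobody parks on an occupied node, so $\pi$ is injective and
each node keeps at most one car. -/
theorem parkable_of_isParkingFunction {V : Type} [Fintype V] [DecidableEq V] {g : V → Option V}
    {m : ℕ} {s : Fin m → V} (h : IsParkingFunction g s) : Parkable g (load s) := by
  obtain ⟨π, hπ⟩ := h
  choose hocc y hy0 hy using fun k => exists_flow_of_parksAt (hπ k)
  have hinj : Function.Injective π := by
    intro j k hjk
    by_contra hne
    rcases lt_or_gt_of_ne hne with hlt | hlt
    · exact hocc k ⟨j, hlt, hjk⟩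
    · exact hocc j ⟨k, hlt, hjk.symm⟩
  refine ⟨∑ k, y k, fun v hv => ?_, fun v => ?_⟩
  · rw [Finset.sum_apply]
    exact sum_eq_zero fun k _ => hy0 k v hv
  · rw [inflow_sum, Finset.sum_apply, load_eq_sum_single, ← sum_add_distrib,
      sum_congr rfl fun k _ => hy k v, sum_add_distrib]
    refine Nat.add_le_add_left ?_ _
    rw [← load_eq_sum_single, load, ← card_filter, card_le_one]
    intro i hi j hj
    simp only [mem_filter, mem_univ, true_and] at hi hj
    exact hinj (hi.trans hj.symm)

/-! ### Driving the cars inside a given flow -/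

section Drive

variable {V : Type} [Fintype V] [DecidableEq V] {g : V → Option V} {x : V → ℕ}

/-- The traffic $z$ so far never exceeds the given flow $x$, and every move uses up one unit of the
remaining capacity $\sum(x-z)$, so the driver stops. -/
theorem exists_parksAt (hx0 : ∀ v, g v = none → x v = 0) {c : V → ℕ}
    (hx : ∀ v, c v + inflow g x v ≤ x v + 1) (occ : Set V) [DecidablePred (· ∈ occ)]
    (z : V → ℕ) (hz : z ≤ x) (v : V)
    (hc : ∀ w, c w + inflow g z w = z w + (if w ∈ occ then 1 else 0) + if v = w then 1 else 0) :
    ∃ p z', z' ≤ x ∧ ParksAt g occ v p ∧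
      ∀ w, c w + inflow g z' w = z' w + (if w ∈ occ then 1 else 0) + if p = w then 1 else 0 := by
  induction hN : ∑ w, (x w - z w) using Nat.strong_induction_on generalizing z v with
  | _ N ih =>
    by_cases hv : v ∈ occ
    · have h1 := hc v
      rw [if_pos hv, if_pos rfl] at h1
      have h2 := inflow_mono g hz v
      have h3 := hx v
      -- An occupied node holding the new driver satisfies $z_v+2=c_v+\mathrm{inflow}_z(v)\le
      -- c_v+\mathrm{inflow}_x(v)\le x_v+1$. So there is spare capacity at $v$, and in particular an
      -- outgoing edge.
      have h4 : z v < x v := by omega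
      cases hgv : g v with
      | none => have := hx0 v hgv; omega
      | some u =>
        have hz' : z + Pi.single v 1 ≤ x := by
          intro w
          rcases eq_or_ne w v with rfl | hwv
          · simpa using h4
          · simpa [hwv] using hz w
        have hlt : ∑ w, (x w - (z + Pi.single v 1 : V → ℕ) w) < N := by
          rw [← hN]
          refine sum_lt_sum (fun w _ => ?_) ⟨v, mem_univ v, ?_⟩
          · rw [Pi.add_apply]; omega
          · rw [Pi.add_apply, Pi.single_eq_same]; omega
        obtain ⟨p, z', h5, h6, h7⟩ := ih _ hlt _ hz' u (fun w => by
          rw [inflow_add, inflow_single_of_eq g hgv, Pi.add_apply, Pi.single_apply,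
            Pi.single_apply]
          have h8 := hc w
          simp only [eq_comm (a := w)]
          omega) rfl
        exact ⟨p, z', h5, ParksAt.move v u p hv hgv h6, h7⟩
    · exact ⟨v, z, hz, ParksAt.park v hv, hc⟩

theorem exists_isParkingFunction (hx0 : ∀ v, g v = none → x v = 0) {m : ℕ} (s : Fin m → V)
    (hx : ∀ v, load s v + inflow g x v ≤ x v + 1) :
    ∃ (π : Fin m → V) (z : V → ℕ), z ≤ x ∧
      (∀ k, ParksAt g {v | ∃ j < k, π j = v} (s k) (π k)) ∧
      ∀ v, load s v + inflow g z v = z v + if v ∈ Set.range π then 1 else 0 := by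
  classical
  induction m with
  | zero => exact ⟨Fin.elim0, 0, fun _ => Nat.zero_le _, fun k => k.elim0, by
      simp [load, inflow_zero]⟩
  | succ m ih =>
    have hload : ∀ v, load s v = load (fun k : Fin m => s k.castSucc) v
        + if s (Fin.last m) = v then 1 else 0 := fun v => Fin.sum_univ_castSucc _
    obtain ⟨π, z, hz, hπ, hc⟩ := ih (fun k => s k.castSucc) fun v => by
      have := hx v
      rw [hload] at this
      omega
    obtain ⟨p, z', hz', hp, hc'⟩ := exists_parksAt hx0 hx (Set.range π) z hz (s (Fin.last m))
      fun w => by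
        have := hc w
        rw [hload]
        omega
    refine ⟨Fin.snoc π p, z', hz', fun k => ?_, fun v => ?_⟩
    · refine Fin.lastCases ?_ (fun k => ?_) k
      · rw [Fin.snoc_last]
        convert hp using 1
        ext v
        constructor
        · rintro ⟨j, hj, rfl⟩
          obtain ⟨i, rfl⟩ := Fin.exists_castSucc_eq.2 hj.ne
          exact ⟨i, by simp⟩
        · rintro ⟨i, rfl⟩
          exact ⟨i.castSucc, Fin.castSucc_lt_last i, by simp⟩
      · rw [Fin.snoc_castSucc]
        convert hπ k using 1
        ext v
        constructor
        · rintro ⟨j, hj, rfl⟩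
          obtain ⟨i, rfl⟩ := Fin.exists_castSucc_eq.2 (hj.trans (Fin.castSucc_lt_last k)).ne
          exact ⟨i, by simpa using hj, by simp⟩
        · rintro ⟨i, hi, rfl⟩
          exact ⟨i.castSucc, by simpa using hi, by simp⟩
    · rw [hc' v, add_assoc]
      congr 1
      have hp' := (exists_flow_of_parksAt hp).1
      have hr : v ∈ Set.range (Fin.snoc π p : Fin (m + 1) → V) ↔ v ∈ Set.range π ∨ p = v := by
        simp only [Set.mem_range, Fin.exists_fin_succ', Fin.snoc_castSucc, Fin.snoc_last]
      by_cases h1 : v ∈ Set.range π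
      · have h2 : p ≠ v := fun h => hp' (h ▸ h1)
        rw [if_pos h1, if_pos (hr.2 (Or.inl h1)), if_neg h2]
      · by_cases h2 : p = v
        · rw [if_neg h1, if_pos h2, if_pos (hr.2 (Or.inr h2))]
        · rw [if_neg h1, if_neg h2, if_neg fun h => (hr.1 h).elim h1 h2]

end Drive

theorem isParkingFunction_iff {V : Type} [Fintype V] [DecidableEq V] {g : V → Option V} {m : ℕ}
    {s : Fin m → V} : IsParkingFunction g s ↔ Parkable g (load s) := by
  refine ⟨parkable_of_isParkingFunction, ?_⟩
  rintro ⟨x, hx0, hx⟩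
  obtain ⟨π, -, -, hπ, -⟩ := exists_isParkingFunction hx0 s hx
  exact ⟨π, hπ⟩

theorem Parkable.sum_le {V : Type} [Fintype V] {g : V → Option V} {c : V → ℕ}
    (h : Parkable g c) : ∑ v, c v ≤ Fintype.card V := by
  classical
  obtain ⟨x, hx0, hx⟩ := h
  have h1 := sum_le_sum fun v (_ : v ∈ univ) => hx v
  rw [sum_add_distrib, sum_add_distrib, sum_inflow g x hx0] at h1
  simp at h1
  omega

end RoadNet

/-! ### Weights of load vectors -/

namespace RoadNet

open Finset

/-- Expand $(\sum_v X_v)^m$ over sequences and by the multinomial theorem, and compare the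
coefficients of $X^c$. -/
theorem card_load_eq {V : Type} [Fintype V] [DecidableEq V] {m : ℕ} (c : V → ℕ)
    (hc : ∑ v, c v = m) :
    #{s : Fin m → V | load s = c} = Nat.multinomial univ c := by
  classical
  have h1 : (∑ v, (MvPolynomial.X v : MvPolynomial V ℕ)) ^ m
      = ∑ s : Fin m → V, MvPolynomial.monomial (Finsupp.equivFunOnFinite.symm (load s)) 1 := by
    rw [Fintype.sum_pow]
    refine sum_congr rfl fun s _ => ?_
    have : Finsupp.equivFunOnFinite.symm (load s) = ∑ k, Finsupp.single (s k) 1 := by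
      ext v
      simp [load, Finsupp.single_apply]
    rw [this, MvPolynomial.monomial_sum_one]
    rfl
  have h2 := sum_pow_eq_sum_piAntidiag univ (fun v => (MvPolynomial.X v : MvPolynomial V ℕ)) m
  have h3 : ∀ k : V → ℕ, ∏ v, (MvPolynomial.X v : MvPolynomial V ℕ) ^ k v
      = MvPolynomial.monomial (Finsupp.equivFunOnFinite.symm k) 1 := fun k => by
    rw [MvPolynomial.monomial_eq, Finsupp.prod_fintype _ _ (by simp)]
    simp
  rw [h1] at h2
  have h4 := congrArg (MvPolynomial.coeff (Finsupp.equivFunOnFinite.symm c)) h2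
  simp only [h3, MvPolynomial.coeff_sum, MvPolynomial.coeff_monomial, EmbeddingLike.apply_eq_iff_eq,
    ← nsmul_eq_mul, MvPolynomial.coeff_smul] at h4
  rw [card_filter, h4, sum_eq_single c]
  · simp
  · intro k _ hk
    simp [hk]
  · intro h
    exact absurd (mem_piAntidiag.2 ⟨hc, fun _ _ => mem_univ _⟩) h

/-- The load vectors with property `P`; they may not exceed the number of nodes. -/
noncomputable def loads {V : Type} [Fintype V] (P : (V → ℕ) → Prop) : Finset (V → ℕ) :=
  open Classical in {c ∈ Fintype.piFinset fun _ => range (Fintype.card V + 1) | P c}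

theorem mem_loads {V : Type} [Fintype V] {P : (V → ℕ) → Prop}
    (hP : ∀ c, P c → ∑ v, c v ≤ Fintype.card V) {c : V → ℕ} : c ∈ loads P ↔ P c := by
  classical
  rw [loads, mem_filter, Fintype.mem_piFinset, and_iff_right_iff_imp]
  intro h v
  rw [mem_range, Nat.lt_succ_iff]
  exact (single_le_sum (fun _ _ => Nat.zero_le _) (mem_univ v)).trans (hP c h)

/-- The weight `1 / ∏ cᵥ!` of a load vector. -/
noncomputable def loadWeight {V : Type} [Fintype V] (c : V → ℕ) : ℚ := ∏ v, 1 / ((c v).factorial : ℚ)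

/-- The generating polynomial of the load vectors with property `P`, in which the power of `u`
is the number of nodes in excess of the number of cars. -/
noncomputable def loadPoly {V : Type} [Fintype V] (P : (V → ℕ) → Prop) : Polynomial ℚ :=
  ∑ c ∈ loads P, Polynomial.monomial (Fintype.card V - ∑ v, c v) (loadWeight c)

theorem card_load_mul {V : Type} [Fintype V] [DecidableEq V] {m : ℕ} (c : V → ℕ)
    (hc : ∑ v, c v = m) :
    (#{s : Fin m → V | load s = c} : ℚ) = m.factorial * loadWeight c := by
  rw [card_load_eq c hc, loadWeight, prod_div_distrib, prod_const_one, mul_one_div]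
  have h1 : ∏ v, ((c v).factorial : ℚ) ≠ 0 :=
    prod_ne_zero_iff.2 fun v _ => by exact_mod_cast (c v).factorial_ne_zero
  rw [eq_div_iff h1, mul_comm]
  have := Nat.multinomial_spec univ c
  rw [hc] at this
  exact_mod_cast this

/-- Whether a sequence parks depends only on its load vector $c$, and $m!/\prod_v c_v!$ sequences of
$m$ drivers share it. -/
theorem coeff_loadPoly {V : Type} [Fintype V] [DecidableEq V] {P : (V → ℕ) → Prop}
    (hP : ∀ c, P c → ∑ v, c v ≤ Fintype.card V) {k : ℕ} (hk : k ≤ Fintype.card V) :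
    ((Fintype.card V - k).factorial : ℚ) * (loadPoly P).coeff k
      = Nat.card {s : Fin (Fintype.card V - k) → V // P (load s)} := by
  classical
  rw [Nat.card_eq_fintype_card, Fintype.card_subtype,
    card_eq_sum_card_fiberwise (f := load) (t := {c ∈ loads P | ∑ v, c v = Fintype.card V - k})]
  · rw [loadPoly, Polynomial.finsetSum_coeff, sum_filter, mul_sum]
    push_cast
    refine sum_congr rfl fun c hc => ?_
    have h1 := hP c ((mem_loads hP).1 hc)
    rw [Polynomial.coeff_monomial]
    by_cases h2 : ∑ v, c v = Fintype.card V - k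
    · rw [if_pos h2, if_pos (by omega), ← card_load_mul c h2]
      congr 2
      ext s
      simp only [mem_filter, mem_univ, true_and, iff_and_self]
      rintro rfl
      exact (mem_loads hP).1 hc
    · rw [if_neg h2, if_neg (by omega)]
      simp
  · intro s hs
    simp only [coe_filter, mem_univ, true_and, Set.mem_ofPred_eq] at hs ⊢
    refine ⟨(mem_loads hP).2 hs, ?_⟩
    simp only [load]
    rw [sum_comm]
    simp

theorem coeff_loadPoly_of_lt {V : Type} [Fintype V] {P : (V → ℕ) → Prop} {k : ℕ}
    (hk : Fintype.card V < k) : (loadPoly P).coeff k = 0 := by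
  rw [loadPoly, Polynomial.finsetSum_coeff]
  exact sum_eq_zero fun c _ => by rw [Polynomial.coeff_monomial, if_neg (by omega)]

/-- The bounds `h₁` and `h₂` make the truncated differences in the exponents of $u$ genuine, so that
the exponents add. -/
theorem loadPoly_mul {A B V : Type} [Fintype A] [Fintype B] [Fintype V] (e : A ⊕ B ≃ V)
    {P : (V → ℕ) → Prop} {P₁ : (A → ℕ) → Prop} {P₂ : (B → ℕ) → Prop}
    (h₁ : ∀ c, P₁ c → ∑ v, c v ≤ Fintype.card A) (h₂ : ∀ c, P₂ c → ∑ v, c v ≤ Fintype.card B)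
    (h : ∀ c, P c ↔ P₁ (fun a => c (e (Sum.inl a))) ∧ P₂ (fun b => c (e (Sum.inr b)))) :
    loadPoly P = loadPoly P₁ * loadPoly P₂ := by
  classical
  have hs : ∀ c : V → ℕ, ∑ v, c v = ∑ a, c (e (Sum.inl a)) + ∑ b, c (e (Sum.inr b)) := fun c => by
    rw [← e.sum_comp, Fintype.sum_sum_type]
  have hV : Fintype.card V = Fintype.card A + Fintype.card B := by
    rw [← Fintype.card_congr e, Fintype.card_sum]
  have hP : ∀ c, P c → ∑ v, c v ≤ Fintype.card V := fun c hc => by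
    rw [hs, hV]
    exact Nat.add_le_add (h₁ _ ((h c).1 hc).1) (h₂ _ ((h c).1 hc).2)
  rw [loadPoly, loadPoly, loadPoly, sum_mul_sum, ← sum_product']
  refine sum_nbij' (fun c => (fun a => c (e (Sum.inl a)), fun b => c (e (Sum.inr b))))
    (fun p v => Sum.elim p.1 p.2 (e.symm v)) ?_ ?_ ?_ ?_ ?_
  · intro c hc
    rw [mem_loads hP, h] at hc
    rw [mem_product, mem_loads h₁, mem_loads h₂]
    exact hc
  · intro p hp
    rw [mem_product, mem_loads h₁, mem_loads h₂] at hp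
    rw [mem_loads hP, h]
    simpa using hp
  · intro c _
    funext v
    obtain ⟨x, rfl⟩ := e.surjective v
    rcases x with a | b <;> simp
  · intro p _
    simp
  · intro c hc
    rw [mem_loads hP, h] at hc
    have h3 := h₁ _ hc.1
    have h4 := h₂ _ hc.2
    rw [Polynomial.monomial_mul_monomial, hs, hV]
    congr 1
    · congr 1
      dsimp only at h3 h4 ⊢
      omega
    · rw [loadWeight, ← e.prod_comp, Fintype.prod_sum_type]
      rfl

end RoadNet

/-! ### Acyclic nets and minimal flows -/

namespace RoadNet

open Finset

/-- No set of nodes is closed under moving on. -/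
def Acyclic {V : Type} (g : V → Option V) : Prop :=
  ∀ Z : Set V, (∀ v ∈ Z, ∃ w ∈ Z, g v = some w) → Z = ∅

/-- The net `h` contains all edges of `g`. -/
def Extends {V : Type} (g h : V → Option V) : Prop := ∀ v, g v = none ∨ g v = h v

/-- In the acyclic net `g`, there is a positive flow of cars through each edge, and in the end
no node has to keep more than one car. -/
def PrimeForest {V : Type} [Fintype V] (g : V → Option V) (c : V → ℕ) : Prop :=
  Acyclic g ∧ ∃ x : V → ℕ, (∀ v, x v = 0 ↔ g v = none) ∧ ∀ v, x v = c v + inflow g x v - 1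

section Acyclic

variable {V : Type} {g h : V → Option V}

theorem Acyclic.induction (hg : Acyclic g) {P : V → Prop}
    (H : ∀ v, (∀ w, g v = some w → P w) → P v) (v : V) : P v := by
  have h1 := hg {v | ¬ P v} fun v hv => by
    by_contra h2
    push Not at h2
    refine hv (H v fun w hw => ?_)
    by_contra h3
    exact h2 w h3 hw
  by_contra h2
  exact Set.eq_empty_iff_forall_notMem.1 h1 v h2

theorem Acyclic.ne (hg : Acyclic g) {v : V} : g v ≠ some v := by
  intro h1
  have := hg {v} fun w hw => by
    rw [Set.mem_singleton_iff] at hw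
    exact ⟨v, rfl, hw ▸ h1⟩
  exact Set.singleton_ne_empty v this

theorem Acyclic.of_extends (hh : Acyclic h) (hgh : Extends g h) : Acyclic g := fun Z hZ =>
  hh Z fun v hv => by
    obtain ⟨w, hw, hvw⟩ := hZ v hv
    refine ⟨w, hw, ?_⟩
    rcases hgh v with h1 | h1
    · rw [h1] at hvw
      exact absurd hvw (by simp)
    · rw [← h1, hvw]

/-- A choice of predecessors is an injection $Z\to Z$, because each node has at most one successor.
By finiteness it is onto, so $Z$ is also closed under moving on. -/
theorem Acyclic.eq_empty_of_forall_exists_pred [Finite V] (hg : Acyclic g) {Z : Set V}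
    (hZ : ∀ v ∈ Z, ∃ w ∈ Z, g w = some v) : Z = ∅ := by
  choose p hp hgp using hZ
  let q : Z → Z := fun v => ⟨p v v.2, hp v v.2⟩
  have hq : Function.Injective q := by
    intro v v' h1
    have h2 : p v v.2 = p v' v'.2 := congrArg Subtype.val h1
    have h3 := hgp v v.2
    rw [h2, hgp v' v'.2] at h3
    exact Subtype.ext (Option.some.inj h3).symm
  refine hg Z fun w hw => ?_
  obtain ⟨v, hv⟩ := (Finite.injective_iff_surjective.1 hq) ⟨w, hw⟩
  have h2 : p v v.2 = w := congrArg Subtype.val hv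
  exact ⟨v, v.2, by rw [← h2, hgp]⟩

theorem Acyclic.exists_root (hg : Acyclic g) :
    ∃ ρ : V → V, (∀ v, g (ρ v) = none) ∧ (∀ v w, g v = some w → ρ v = ρ w) ∧
      (∀ v, g v = none → ρ v = v) ∧
      ∀ v, Relation.ReflTransGen (fun a b => g a = some b) v (ρ v) := by
  have h1 : ∀ v, ∃ r, g r = none ∧ Relation.ReflTransGen (fun a b => g a = some b) v r := by
    refine hg.induction fun v ih => ?_
    cases hv : g v with
    | none => exact ⟨v, hv, .refl⟩
    | some w =>
      obtain ⟨r, hr, hwr⟩ := ih w hv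
      exact ⟨r, hr, .head hv hwr⟩
  have h2 : ∀ v r, g r = none → Relation.ReflTransGen (fun a b => g a = some b) v r →
      ∀ w, g v = some w → Relation.ReflTransGen (fun a b => g a = some b) w r := by
    intro v r hr hvr w hw
    rcases Relation.ReflTransGen.cases_head hvr with rfl | ⟨u, hu, hur⟩
    · rw [hr] at hw
      exact absurd hw (by simp)
    · rw [hu] at hw
      exact Option.some.inj hw ▸ hur
  have h3 : ∀ v, ∀ r r', g r = none → g r' = none →
      Relation.ReflTransGen (fun a b => g a = some b) v r →
      Relation.ReflTransGen (fun a b => g a = some b) v r' → r = r' := by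
    refine hg.induction fun v ih r r' hr hr' hvr hvr' => ?_
    cases hv : g v with
    | none =>
      rcases Relation.ReflTransGen.cases_head hvr with rfl | ⟨u, hu, -⟩
      · rcases Relation.ReflTransGen.cases_head hvr' with rfl | ⟨u, hu, -⟩
        · rfl
        · rw [hv] at hu; exact absurd hu (by simp)
      · rw [hv] at hu; exact absurd hu (by simp)
    | some w => exact ih w hv r r' hr hr' (h2 v r hr hvr w hv) (h2 v r' hr' hvr' w hv)
  choose ρ hρ hρ' using h1
  exact ⟨ρ, hρ, fun v w hvw => h3 w _ _ (hρ v) (hρ w) (h2 v _ (hρ v) (hρ' v) w hvw) (hρ' w),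
    fun v hv => h3 v _ _ (hρ v) hv (hρ' v) .refl, hρ'⟩

end Acyclic

section MinimalFlow

variable {V : Type} [Fintype V] {g h : V → Option V} {c : V → ℕ}

theorem inflow_eq_of_extends (hgh : Extends g h) {x : V → ℕ} (hx : ∀ v, g v = none → x v = 0)
    (v : V) : inflow h x v = inflow g x v := by
  refine sum_congr rfl fun w _ => ?_
  rcases hgh w with h1 | h1
  · simp [hx w h1]
  · rw [h1]

theorem PrimeForest.parkable (hg : PrimeForest g c) (hgh : Extends g h) : Parkable h c := by
  obtain ⟨-, x, hx0, hx⟩ := hg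
  refine ⟨x, fun v hv => (hx0 v).2 ?_, fun v => ?_⟩
  · rcases hgh v with h1 | h1
    · exact h1
    · rw [h1, hv]
  · rw [inflow_eq_of_extends hgh fun v => (hx0 v).2]
    have := hx v
    omega

theorem PrimeForest.sum_le (hg : PrimeForest g c) : ∑ v, c v ≤ Fintype.card V :=
  (hg.parkable fun _ => Or.inr rfl).sum_le

/-- The flow of a prime forest is the least feasible one. Where $x'<x$, the inflow of $x'$ is
smaller as well, so some predecessor has $x'<x$ too; its flow $x$ is positive, so its edge lies in
$g$. An acyclic finite net has no non-empty set closed under such predecessors. -/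
theorem flow_le_of_extends (hg : Acyclic g) (hgh : Extends g h) {x x' : V → ℕ}
    (hx0 : ∀ v, x v = 0 ↔ g v = none) (hx : ∀ v, x v = c v + inflow g x v - 1)
    (hx' : ∀ v, c v + inflow h x' v ≤ x' v + 1) : x ≤ x' := by
  have h1 : {v | x' v < x v} = ∅ := by
    refine hg.eq_empty_of_forall_exists_pred fun v (hv : x' v < x v) => ?_
    have h2 : inflow h x' v < inflow h x v := by
      rw [inflow_eq_of_extends hgh fun v => (hx0 v).2]
      have := hx v
      have := hx' v
      omega
    obtain ⟨w, -, hw⟩ := exists_lt_of_sum_lt h2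
    split_ifs at hw with hwv
    · refine ⟨w, hw, ?_⟩
      rcases hgh w with h3 | h3
      · rw [(hx0 w).2 h3] at hw
        exact absurd hw (Nat.not_lt_zero _)
      · rw [h3, hwv]
    · exact absurd hw (lt_irrefl _)
  intro v
  by_contra h2
  exact Set.eq_empty_iff_forall_notMem.1 h1 v (not_le.1 h2)

/-- Both flows are least, hence equal, and the support of the flow determines the edges. -/
theorem PrimeForest.unique {g' : V → Option V} (hg : PrimeForest g c) (hgh : Extends g h)
    (hg' : PrimeForest g' c) (hgh' : Extends g' h) : g = g' := by
  obtain ⟨hg, x, hx0, hx⟩ := hg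
  obtain ⟨hg', x', hx0', hx'⟩ := hg'
  have h1 : ∀ v, c v + inflow h x v ≤ x v + 1 := fun v => by
    rw [inflow_eq_of_extends hgh fun v => (hx0 v).2]
    have := hx v
    omega
  have h1' : ∀ v, c v + inflow h x' v ≤ x' v + 1 := fun v => by
    rw [inflow_eq_of_extends hgh' fun v => (hx0' v).2]
    have := hx' v
    omega
  have hxx' : x = x' := le_antisymm (flow_le_of_extends hg hgh hx0 hx h1')
    (flow_le_of_extends hg' hgh' hx0' hx' h1)
  subst hxx'
  funext v
  by_cases h0 : x v = 0
  · rw [(hx0 v).1 h0, (hx0' v).1 h0]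
  · rcases hgh v with h2 | h2
    · exact absurd ((hx0 v).2 h2) h0
    · rcases hgh' v with h3 | h3
      · exact absurd ((hx0' v).2 h3) h0
      · rw [h2, h3]

/-- Take a feasible flow of least total and keep the edges that carry cars. Minimality forbids
superfluous outflow at a node and circulation around a cycle. -/
theorem exists_primeForest (hc : Parkable h c) : ∃ g, Extends g h ∧ PrimeForest g c := by
  classical
  obtain ⟨x, ⟨hx0, hx⟩, hmin⟩ := (measure fun x : V → ℕ => ∑ v, x v).wf.has_min
    {x | (∀ v, h v = none → x v = 0) ∧ ∀ v, c v + inflow h x v ≤ x v + 1} hc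
  replace hmin : ∀ y : V → ℕ, y ≤ x → (∀ v, c v + inflow h y v ≤ y v + 1) → ∀ v, x v ≤ y v := by
    intro y hy hcy v
    by_contra hv
    refine hmin y ⟨fun v hv => Nat.le_zero.1 (hx0 v hv ▸ hy v), hcy⟩ ?_
    exact sum_lt_sum (fun w _ => hy w) ⟨v, mem_univ v, not_le.1 hv⟩
  -- Otherwise one car fewer could leave $v$. The truncated subtraction covers nodes that no car
  -- reaches.
  have hxeq : ∀ v, x v = c v + inflow h x v - 1 := by
    intro v
    by_contra hne
    have h1 := hx v
    have hle : Function.update x v (x v - 1) ≤ x := by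
      intro w
      rcases eq_or_ne w v with rfl | hw
      · simp
      · simp [hw]
    have h2 := hmin _ hle (fun w => by
      have h3 := inflow_mono h hle w
      have h4 := hx w
      rcases eq_or_ne w v with rfl | hw
      · rw [Function.update_self]
        omega
      · rw [Function.update_of_ne hw]
        omega) v
    rw [Function.update_self] at h2
    omega
  have hext : Extends (fun v => if x v = 0 then none else h v) h := fun v => by
    by_cases h0 : x v = 0
    · exact Or.inl (if_pos h0)
    · exact Or.inr (if_neg h0)
  have hg0 : ∀ v, x v = 0 ↔ (if x v = 0 then none else h v) = none := fun v => by
    constructor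
    · intro h0
      rw [if_pos h0]
    · intro h0
      by_contra h1
      rw [if_neg h1] at h0
      exact h1 (hx0 v h0)
  refine ⟨_, hext, ?_, x, hg0, fun v => ?_⟩
  · intro Z hZ
    by_contra hne
    -- A minimal closed set equals its own image: it is a cycle, and each of its nodes has a
    -- predecessor in it.
    obtain ⟨Y, ⟨hYne, hY⟩, hYmin⟩ := (wellFounded_lt (α := Set V)).has_min
      {Z : Set V | Z.Nonempty ∧ ∀ v ∈ Z, ∃ w ∈ Z, (if x v = 0 then none else h v) = some w}
      ⟨Z, Set.nonempty_iff_ne_empty.2 hne, hZ⟩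
    have hYx : ∀ v ∈ Y, x v ≠ 0 ∧ ∃ w ∈ Y, h v = some w := by
      intro v hv
      obtain ⟨w, hw, hvw⟩ := hY v hv
      split_ifs at hvw with h0
      exact ⟨h0, w, hw, hvw⟩
    let Y' : Set V := {w | ∃ v ∈ Y, h v = some w}
    have hY'Y : Y' ⊆ Y := by
      rintro w ⟨v, hv, hvw⟩
      obtain ⟨-, u, hu, hvu⟩ := hYx v hv
      rw [hvw] at hvu
      exact Option.some.inj hvu ▸ hu
    have hYY' : Y ⊆ Y' := by
      by_contra hnot
      refine hYmin Y' ⟨?_, ?_⟩ ⟨hY'Y, hnot⟩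
      · obtain ⟨v, hv⟩ := hYne
        obtain ⟨-, w, -, hvw⟩ := hYx v hv
        exact ⟨w, v, hv, hvw⟩
      · intro v hv
        obtain ⟨h0, w, -, hvw⟩ := hYx v (hY'Y hv)
        exact ⟨w, ⟨v, hY'Y hv, hvw⟩, by rw [if_neg h0, hvw]⟩
    -- Removing one car from every edge of the cycle lowers inflow and outflow together,
    -- contradicting minimality.
    let y : V → ℕ := fun v => if v ∈ Y then x v - 1 else x v
    let χ : V → ℕ := fun v => if v ∈ Y then 1 else 0
    have hxy : x = y + χ := by
      funext v
      by_cases hv : v ∈ Y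
      · have := (hYx v hv).1
        simp only [Pi.add_apply, y, χ, if_pos hv]
        omega
      · simp [y, χ, hv]
    obtain ⟨v, hv⟩ := hYne
    have hyx : y ≤ x := by
      rw [hxy]
      exact fun v => Nat.le_add_right _ _
    have h1 := hmin y hyx (fun w => by
      have h2 := hx w
      have h3 := inflow_mono h hyx w
      by_cases hw : w ∈ Y
      · obtain ⟨u, hu, huw⟩ := hYY' hw
        have h4 := le_inflow h (x := χ) huw
        have h5 : inflow h x w = inflow h y w + inflow h χ w := by
          rw [← inflow_add, ← hxy]
        have h6 : χ u = 1 := if_pos hu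
        have h7 : y w = x w - 1 := if_pos hw
        have := (hYx w hw).1
        omega
      · have h7 : y w = x w := if_neg hw
        omega) v
    have h7 : y v = x v - 1 := if_pos hv
    have := (hYx v hv).1
    omega
  · rw [← inflow_eq_of_extends hext fun v => (hg0 v).2]
    exact hxeq v

/-- Each parkable pair $(h,c)$ contains exactly one prime forest for $c$; exchange the order of
summation. -/
theorem sum_loadPoly_parkable [DecidableEq V] (H : Finset (V → Option V)) :
    ∑ h ∈ H, loadPoly (Parkable h)
      = open Classical in ∑ g, (#{h ∈ H | Extends g h} : Polynomial ℚ) * loadPoly (PrimeForest g) := by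
  classical
  simp only [loadPoly, loads, sum_filter, mul_sum]
  rw [sum_comm, sum_comm (s := univ)]
  refine sum_congr rfl fun c _ => ?_
  have h1 : ∀ h : V → Option V, (if Parkable h c then (1 : Polynomial ℚ) else 0)
      = ∑ g, if PrimeForest g c ∧ Extends g h then 1 else 0 := by
    intro h
    split_ifs with hc
    · obtain ⟨g, hgh, hg⟩ := exists_primeForest hc
      rw [sum_eq_single g, if_pos ⟨hg, hgh⟩]
      · intro g' _ hne
        exact if_neg fun h' => hne (h'.1.unique h'.2 hg hgh)
      · simp
    · exact (sum_eq_zero fun g _ => if_neg fun h' => hc (h'.1.parkable h'.2)).symm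
  have h2 : ∀ (p : Prop) [Decidable p] (a : Polynomial ℚ),
      (if p then a else 0) = (if p then 1 else 0) * a := fun p _ a => by
    split_ifs <;> simp
  have h3 : ∀ (h : V → Option V) (a : Polynomial ℚ), (if Parkable h c then a else 0)
      = (∑ g, if PrimeForest g c ∧ Extends g h then 1 else 0) * a := fun h a => by
    rw [h2, h1]
  simp only [h3, sum_mul]
  rw [sum_comm]
  refine sum_congr rfl fun g _ => ?_
  rw [card_filter, Nat.cast_sum, sum_mul]
  refine sum_congr rfl fun h _ => ?_
  by_cases h3 : PrimeForest g c <;> by_cases h4 : Extends g h <;> simp [h3, h4]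

end MinimalFlow

end RoadNet

/-! ### Extensions of forests to mappings and trees -/

namespace RoadNet

open Finset

variable {V : Type} [Fintype V]

/-- The nodes without outgoing edge. -/
def roots (g : V → Option V) : Finset V := {v | g v = none}

theorem mem_roots {g : V → Option V} {v : V} : v ∈ roots g ↔ g v = none := by simp [roots]

/-- The rooted trees, as road nets. -/
noncomputable def trees (V : Type) [Fintype V] : Finset (V → Option V) :=
  open Classical in {h | Acyclic h ∧ #(roots h) = 1}

theorem mem_trees {h : V → Option V} : h ∈ trees V ↔ Acyclic h ∧ #(roots h) = 1 := by
  simp [trees]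

theorem card_extends_total (g : V → Option V) :
    (open Classical in #{h : V → Option V | (∀ v, h v ≠ none) ∧ Extends g h})
      = Fintype.card V ^ #(roots g) := by
  classical
  have h1 : (univ.filter fun h : V → Option V => (∀ v, h v ≠ none) ∧ Extends g h)
      = Fintype.piFinset fun v => if g v = none then univ.erase none else {g v} := by
    ext h
    rw [mem_filter_univ, Fintype.mem_piFinset, Extends, ← forall_and]
    refine forall_congr' fun v => ?_
    by_cases hv : g v = none
    · simp [hv]
    · rw [if_neg hv, mem_singleton]
      constructor
      · rintro ⟨-, h2⟩
        exact (h2.resolve_left hv).symm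
      · intro h2
        exact ⟨h2 ▸ hv, Or.inr h2.symm⟩
  rw [h1, Fintype.card_piFinset]
  have h2 : ∀ v, #(if g v = none then univ.erase none else {g v})
      = if v ∈ roots g then Fintype.card V else 1 := fun v => by
    rw [if_congr mem_roots rfl rfl]
    split_ifs
    · rw [card_erase_of_mem (mem_univ _), card_univ, Fintype.card_option, Nat.add_sub_cancel]
    · rfl
  rw [prod_congr rfl fun v _ => h2 v, prod_ite_mem, univ_inter, prod_const]

theorem roots_subset_of_extends {g h : V → Option V} (hgh : Extends g h) : roots h ⊆ roots g := by
  intro v hv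
  rw [mem_roots] at hv ⊢
  rcases hgh v with h1 | h1
  · exact h1
  · rw [h1, hv]

theorem extends_update {V : Type} [DecidableEq V] {g h : V → Option V} {r : V} (v : V) (hr : g r = none) :
    Extends (Function.update g r (some v)) h ↔ Extends g h ∧ h r = some v := by
  constructor
  · intro h1
    have h2 : h r = some v := by
      have := h1 r
      rw [Function.update_self] at this
      simpa [eq_comm] using this
    refine ⟨fun w => ?_, h2⟩
    rcases eq_or_ne w r with rfl | hw
    · exact Or.inl hr
    · simpa [hw] using h1 w
  · rintro ⟨h1, h2⟩ w
    rcases eq_or_ne w r with rfl | hw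
    · rw [Function.update_self]
      exact Or.inr h2.symm
    · simpa [hw] using h1 w

theorem roots_update [DecidableEq V] {g : V → Option V} (r v : V) :
    roots (Function.update g r (some v)) = (roots g).erase r := by
  ext w
  rw [mem_erase, mem_roots, mem_roots]
  rcases eq_or_ne w r with rfl | hw
  · simp
  · simp [hw]

/-- Attaching the root $r$ to $v$ closes a cycle precisely when $v$ already lies in the tree of $r$.
-/
theorem acyclic_update_iff {V : Type} [DecidableEq V] {g : V → Option V} (hg : Acyclic g) {ρ : V → V}
    (hρ : ∀ v w, g v = some w → ρ v = ρ w) (hρ' : ∀ v, g v = none → ρ v = v) {r v : V}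
    (hr : g r = none) : Acyclic (Function.update g r (some v)) ↔ ρ v ≠ r := by
  constructor
  · rintro h1 h2
    have h3 := h1 {w | ρ w = r} fun w (hw : ρ w = r) => by
      rcases eq_or_ne w r with rfl | hwr
      · exact ⟨v, h2, by simp⟩
      · cases hgw : g w with
        | none => exact absurd ((hρ' w hgw).symm.trans hw) hwr
        | some u => exact ⟨u, (hρ w u hgw).symm.trans hw, by simp [hwr, hgw]⟩
    exact Set.eq_empty_iff_forall_notMem.1 h3 r (hρ' r hr)
  · intro h1 Z hZ
    have key : ∀ Y ⊆ Z, (∀ w ∈ Y, w ≠ r) →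
        (∀ w ∈ Y, ∀ u, g w = some u → u ∈ Z → u ∈ Y) → Y = ∅ := by
      intro Y hYZ hYr hY
      refine hg Y fun w hw => ?_
      obtain ⟨u, hu, hwu⟩ := hZ w (hYZ hw)
      rw [Function.update_of_ne (hYr w hw)] at hwu
      exact ⟨u, hY w hw u hwu hu, hwu⟩
    by_cases hrZ : r ∈ Z
    · obtain ⟨u, hu, hru⟩ := hZ r hrZ
      rw [Function.update_self] at hru
      obtain rfl := Option.some.inj hru
      have h2 := key {w | w ∈ Z ∧ ρ w ≠ r} (fun w hw => hw.1)
        (fun w hw hwr => hw.2 (hwr ▸ hρ' r hr))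
        (fun w hw u hwu hu => ⟨hu, fun h => hw.2 ((hρ w u hwu).trans h)⟩)
      exact absurd (show v ∈ {w | w ∈ Z ∧ ρ w ≠ r} from ⟨hu, h1⟩)
        (Set.eq_empty_iff_forall_notMem.1 h2 v)
    · exact key Z le_rfl (fun w hw hwr => hrZ (hwr ▸ hw)) fun _ _ _ _ hu => hu

/-- Double counting of the pairs of an extending tree $h$ and a root of $g$ that is no longer a root
in $h$. With $k+2$ roots, every $h$ has $k+1$ of them. Conversely, choose the new parent $v$ freely
and then one of the $k+1$ roots other than that of $v$; what remains is a forest with $k+1$ roots.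
-/
theorem card_extends_trees_aux (k : ℕ) : ∀ g : V → Option V, Acyclic g → #(roots g) = k + 1 →
    (open Classical in #{h ∈ trees V | Extends g h}) = Fintype.card V ^ k := by
  classical
  induction k with
  | zero =>
    intro g hg hk
    rw [pow_zero, card_eq_one]
    refine ⟨g, ?_⟩
    ext h
    rw [mem_filter, mem_singleton, mem_trees]
    constructor
    · rintro ⟨⟨-, h1⟩, hgh⟩
      have h2 := eq_of_subset_of_card_le (roots_subset_of_extends hgh) (by omega)
      funext v
      rcases hgh v with h3 | h3
      · rw [h3, ← mem_roots, h2, mem_roots, h3]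
      · exact h3.symm
    · rintro rfl
      exact ⟨⟨hg, hk⟩, fun _ => Or.inr rfl⟩
  | succ k ih =>
    intro g hg hk
    obtain ⟨ρ, hρr, hρ, hρ', -⟩ := hg.exists_root
    have h1 : ∀ h ∈ {h ∈ trees V | Extends g h}, #{r ∈ roots g | h r ≠ none} = k + 1 := by
      intro h hh
      rw [mem_filter, mem_trees] at hh
      have h2 : {r ∈ roots g | h r ≠ none} = roots g \ roots h := by
        ext r
        rw [mem_filter, mem_sdiff, mem_roots, mem_roots]
      rw [h2, card_sdiff_of_subset (roots_subset_of_extends hh.2), hk, hh.1.2]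
      omega
    have h2 : ∑ h ∈ {h ∈ trees V | Extends g h}, #{r ∈ roots g | h r ≠ none}
        = ∑ v, ∑ r ∈ roots g, #{h ∈ trees V | Extends (Function.update g r (some v)) h} := by
      have h3 : ∀ h : V → Option V, #{r ∈ roots g | h r ≠ none}
          = ∑ v, ∑ r ∈ roots g, if h r = some v then 1 else 0 := by
        intro h
        rw [sum_comm, card_filter]
        refine sum_congr rfl fun r _ => ?_
        cases h r <;> simp
      rw [sum_congr rfl fun h _ => h3 h, sum_comm]
      refine sum_congr rfl fun v _ => ?_
      rw [sum_comm]
      refine sum_congr rfl fun r hr => ?_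
      rw [← card_filter, filter_filter]
      congr 1
      refine filter_congr fun h _ => ?_
      rw [extends_update v (mem_roots.1 hr)]
    have h3 : ∀ v, ∀ r ∈ roots g, #{h ∈ trees V | Extends (Function.update g r (some v)) h}
        = if ρ v = r then 0 else Fintype.card V ^ k := by
      intro v r hr
      have h4 := acyclic_update_iff hg hρ hρ' (v := v) (mem_roots.1 hr)
      split_ifs with h5
      · rw [card_eq_zero, filter_eq_empty_iff]
        intro h hh hgh
        exact h4.1 ((mem_trees.1 hh).1.of_extends hgh) h5
      · refine ih _ (h4.2 h5) ?_
        rw [roots_update, card_erase_of_mem hr, hk]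
        rfl
    have h4 : ∀ v, ∑ r ∈ roots g, #{h ∈ trees V | Extends (Function.update g r (some v)) h}
        = (k + 1) * Fintype.card V ^ k := by
      intro v
      rw [sum_congr rfl (h3 v), ← sum_erase_add _ _ (mem_roots.2 (hρr v)), if_pos rfl, add_zero,
        sum_congr rfl fun r hr => if_neg (ne_of_mem_erase hr).symm, sum_const,
        card_erase_of_mem (mem_roots.2 (hρr v)), hk, smul_eq_mul]
      rfl
    rw [sum_congr rfl h1, sum_congr rfl fun v _ => h4 v, sum_const, sum_const, card_univ,
      smul_eq_mul, smul_eq_mul] at h2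
    refine Nat.eq_of_mul_eq_mul_right (Nat.succ_pos k) (h2.trans ?_)
    rw [pow_succ, Nat.succ_eq_add_one]
    ring

theorem card_mul_card_extends_trees [Nonempty V] {g : V → Option V} (hg : Acyclic g) :
    Fintype.card V * (open Classical in #{h ∈ trees V | Extends g h})
      = Fintype.card V ^ #(roots g) := by
  obtain ⟨ρ, hρr, -⟩ := hg.exists_root
  have h1 : #(roots g) ≠ 0 := card_ne_zero_of_mem (mem_roots.2 (hρr (Classical.arbitrary V)))
  obtain ⟨k, hk⟩ := Nat.exists_eq_succ_of_ne_zero h1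
  rw [card_extends_trees_aux k g hg hk, hk, pow_succ, mul_comm]

end RoadNet

/-! ### Multiplicativity of the weights -/

namespace RoadNet

open Finset

section Glue

variable {A B V : Type} [Fintype A] [Fintype B] [Fintype V] {e : A ⊕ B ≃ V}
  {g₁ : A → Option A} {g₂ : B → Option B}

theorem inflow_glue_inl (x : V → ℕ) (a : A) :
    inflow (glue e g₁ g₂) x (e (Sum.inl a)) = inflow g₁ (fun a => x (e (Sum.inl a))) a := by
  classical
  rw [inflow, inflow, ← e.sum_comp, Fintype.sum_sum_type]
  refine (congrArg₂ (· + ·) ?_ ?_).trans (add_zero _)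
  · refine sum_congr rfl fun w _ => if_congr ?_ rfl rfl
    rw [glue_inl, Option.map_eq_some_iff]
    simp
  · refine sum_eq_zero fun w _ => if_neg ?_
    rw [glue_inr, Option.map_eq_some_iff]
    simp

theorem inflow_glue_inr (x : V → ℕ) (b : B) :
    inflow (glue e g₁ g₂) x (e (Sum.inr b)) = inflow g₂ (fun b => x (e (Sum.inr b))) b := by
  classical
  rw [inflow, inflow, ← e.sum_comp, Fintype.sum_sum_type]
  rw [add_comm]
  refine (congrArg₂ (· + ·) ?_ ?_).trans (add_zero _)
  · refine sum_congr rfl fun w _ => if_congr ?_ rfl rfl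
    rw [glue_inr, Option.map_eq_some_iff]
    simp
  · refine sum_eq_zero fun w _ => if_neg ?_
    rw [glue_inl, Option.map_eq_some_iff]
    simp

omit [Fintype A] [Fintype B] [Fintype V] in
theorem exists_equiv_sum (e : A ⊕ B ≃ V) {p : (A → ℕ) → (B → ℕ) → Prop} :
    (∃ x : V → ℕ, p (fun a => x (e (Sum.inl a))) fun b => x (e (Sum.inr b))) ↔ ∃ x y, p x y := by
  constructor
  · rintro ⟨x, hx⟩
    exact ⟨_, _, hx⟩
  · rintro ⟨x, y, h⟩
    exact ⟨fun v => Sum.elim x y (e.symm v), by simpa using h⟩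

theorem parkable_glue (c : V → ℕ) : Parkable (glue e g₁ g₂) c ↔
    Parkable g₁ (fun a => c (e (Sum.inl a))) ∧ Parkable g₂ fun b => c (e (Sum.inr b)) := by
  simp only [Parkable, forall_equiv_sum (e := e), glue_inl, glue_inr, Option.map_eq_none_iff,
    inflow_glue_inl, inflow_glue_inr]
  rw [exists_equiv_sum e (p := fun x y => ((∀ a, g₁ a = none → x a = 0) ∧
    ∀ b, g₂ b = none → y b = 0) ∧ (∀ a, c (e (Sum.inl a)) + inflow g₁ x a ≤ x a + 1) ∧
    ∀ b, c (e (Sum.inr b)) + inflow g₂ y b ≤ y b + 1)]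
  constructor
  · rintro ⟨x, y, ⟨h1, h2⟩, h3, h4⟩
    exact ⟨⟨x, h1, h3⟩, y, h2, h4⟩
  · rintro ⟨⟨x, h1, h3⟩, y, h2, h4⟩
    exact ⟨x, y, ⟨h1, h2⟩, h3, h4⟩

omit [Fintype A] [Fintype B] [Fintype V] in
theorem acyclic_glue : Acyclic (glue e g₁ g₂) ↔ Acyclic g₁ ∧ Acyclic g₂ := by
  constructor
  · intro h
    constructor
    · intro Z hZ
      have := h ((fun a => e (Sum.inl a)) '' Z) (by
        rintro _ ⟨a, ha, rfl⟩
        obtain ⟨a', ha', h1⟩ := hZ a ha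
        exact ⟨_, ⟨a', ha', rfl⟩, by simp [h1]⟩)
      exact Set.image_eq_empty.1 this
    · intro Z hZ
      have := h ((fun b => e (Sum.inr b)) '' Z) (by
        rintro _ ⟨b, hb, rfl⟩
        obtain ⟨b', hb', h1⟩ := hZ b hb
        exact ⟨_, ⟨b', hb', rfl⟩, by simp [h1]⟩)
      exact Set.image_eq_empty.1 this
  · rintro ⟨h1, h2⟩ Z hZ
    have h3 := h1 {a | e (Sum.inl a) ∈ Z} fun a ha => by
      obtain ⟨w, hw, haw⟩ := hZ _ ha
      rw [glue_inl, Option.map_eq_some_iff] at haw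
      obtain ⟨a', ha', rfl⟩ := haw
      exact ⟨a', hw, ha'⟩
    have h4 := h2 {b | e (Sum.inr b) ∈ Z} fun b hb => by
      obtain ⟨w, hw, hbw⟩ := hZ _ hb
      rw [glue_inr, Option.map_eq_some_iff] at hbw
      obtain ⟨b', hb', rfl⟩ := hbw
      exact ⟨b', hw, hb'⟩
    rw [Set.eq_empty_iff_forall_notMem] at h3 h4 ⊢
    exact forall_equiv_sum.2 ⟨h3, h4⟩

theorem primeForest_glue (c : V → ℕ) : PrimeForest (glue e g₁ g₂) c ↔
    PrimeForest g₁ (fun a => c (e (Sum.inl a))) ∧ PrimeForest g₂ fun b => c (e (Sum.inr b)) := by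
  simp only [PrimeForest, forall_equiv_sum (e := e), glue_inl, glue_inr, Option.map_eq_none_iff,
    inflow_glue_inl, inflow_glue_inr, acyclic_glue]
  rw [exists_equiv_sum e (p := fun x y => ((∀ a, x a = 0 ↔ g₁ a = none) ∧
    ∀ b, y b = 0 ↔ g₂ b = none) ∧ (∀ a, x a = c (e (Sum.inl a)) + inflow g₁ x a - 1) ∧
    ∀ b, y b = c (e (Sum.inr b)) + inflow g₂ y b - 1)]
  constructor
  · rintro ⟨⟨h5, h6⟩, x, y, ⟨h1, h2⟩, h3, h4⟩
    exact ⟨⟨h5, x, h1, h3⟩, h6, y, h2, h4⟩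
  · rintro ⟨⟨h5, x, h1, h3⟩, h6, y, h2, h4⟩
    exact ⟨⟨h5, h6⟩, x, y, ⟨h1, h2⟩, h3, h4⟩

theorem card_roots_glue : #(roots (glue e g₁ g₂)) = #(roots g₁) + #(roots g₂) := by
  classical
  simp only [roots, card_filter]
  rw [← e.sum_comp, Fintype.sum_sum_type]
  simp

end Glue

theorem loadPoly_of_isEmpty {V : Type} [Fintype V] [IsEmpty V] {P : (V → ℕ) → Prop}
    (hP : ∀ c, P c) : loadPoly P = 1 := by
  have h1 : loads P = {fun v => isEmptyElim v} := by
    ext c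
    rw [mem_loads (by simp), mem_singleton]
    exact ⟨fun _ => Subsingleton.elim _ _, fun _ => hP c⟩
  rw [loadPoly, h1, sum_singleton]
  simp [loadWeight]

/-- The weight of a net for the parking functions on mappings. -/
noncomputable def mappingWeight {V : Type} [Fintype V] (g : V → Option V) : Polynomial ℚ :=
  open Classical in if ∀ v, g v ≠ none then loadPoly (Parkable g) else 0

/-- The weight of a net for prime forests, each tree being marked with one of `a` colours. -/
noncomputable def forestWeight (a : ℕ) {V : Type} [Fintype V] (g : V → Option V) :
    Polynomial ℚ := (a : Polynomial ℚ) ^ #(roots g) * loadPoly (PrimeForest g)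

theorem isMultiplicative_mappingWeight : IsMultiplicative mappingWeight where
  glue e g₁ g₂ := by
    have h1 : (∀ v, glue e g₁ g₂ v ≠ none) ↔ (∀ a, g₁ a ≠ none) ∧ ∀ b, g₂ b ≠ none := by
      rw [forall_equiv_sum (e := e)]
      simp
    rw [mappingWeight, mappingWeight, mappingWeight,
      loadPoly_mul e (fun _ h => h.sum_le) (fun _ h => h.sum_le) parkable_glue]
    split_ifs <;> simp_all
  empty g := by
    rw [mappingWeight, if_pos fun v => isEmptyElim v]
    exact loadPoly_of_isEmpty fun c => ⟨c, fun v => isEmptyElim v, fun v => isEmptyElim v⟩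

theorem isMultiplicative_forestWeight (a : ℕ) : IsMultiplicative (forestWeight a) where
  glue e g₁ g₂ := by
    rw [forestWeight, forestWeight, forestWeight, card_roots_glue, pow_add,
      loadPoly_mul e (fun _ h => h.sum_le) (fun _ h => h.sum_le) primeForest_glue]
    ring
  empty g := by
    have h1 : roots g = ∅ := by
      ext v
      exact isEmptyElim v
    rw [forestWeight, h1, card_empty, pow_zero, one_mul]
    exact loadPoly_of_isEmpty fun c => ⟨fun Z _ => Set.eq_empty_of_isEmpty Z, c,
      fun v => isEmptyElim v, fun v => isEmptyElim v⟩

/-! ### Connected nets -/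

theorem Acyclic.isConnected_iff {V : Type} [Fintype V] {g : V → Option V} (hg : Acyclic g) :
    IsConnected g ↔ #(roots g) = 1 := by
  obtain ⟨ρ, hρr, hρ, hρ', -⟩ := hg.exists_root
  constructor
  · rintro ⟨⟨v₀⟩, h⟩
    refine card_eq_one.2 ⟨ρ v₀, ?_⟩
    ext v
    rw [mem_roots, mem_singleton]
    constructor
    · intro hv
      have := h {w | ρ w = ρ v₀} (fun u w huw => by
        show ρ u = ρ v₀ ↔ ρ w = ρ v₀
        rw [hρ u w huw]) ⟨v₀, rfl⟩ v
      exact (hρ' v hv).symm.trans this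
    · rintro rfl
      exact hρr v₀
  · intro h
    obtain ⟨r, hr⟩ := card_eq_one.1 h
    have h1 : ∀ v, ρ v = r := fun v => by
      rw [← mem_singleton, ← hr, mem_roots]
      exact hρr v
    refine ⟨⟨r⟩, fun Z hZ ⟨z, hz⟩ => ?_⟩
    have h2 : ∀ v, v ∈ Z ↔ r ∈ Z := by
      refine hg.induction fun v ih => ?_
      cases hv : g v with
      | none => rw [← hρ' v hv, h1]
      | some w => rw [hZ v w hv, ih w hv]
    exact fun v => (h2 v).2 ((h2 z).1 hz)

theorem isConnected_some_iff {V : Type} (f : V → V) :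
    IsConnected (fun v => some (f v)) ↔ IsConnectedMapping f := by
  rw [IsConnectedMapping, SimpleGraph.connected_iff, and_comm, IsConnected]
  refine and_congr_right fun _ => ?_
  constructor
  · intro h v
    refine h {w | (SimpleGraph.fromRel fun i j => f i = j).Reachable v w} ?_ ⟨v, .refl v⟩
    intro a b hab
    obtain rfl := Option.some.inj hab
    have h1 : (SimpleGraph.fromRel fun i j => f i = j).Reachable a (f a) := by
      rcases eq_or_ne a (f a) with h2 | h2
      · rw [← h2]
      · exact SimpleGraph.Adj.reachable ((SimpleGraph.fromRel_adj _ _ _).2 ⟨h2, Or.inl rfl⟩)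
    exact ⟨fun h => h.trans h1, fun h => h.trans h1.symm⟩
  · rintro h Z hZ ⟨z, hz⟩ v
    have h1 := h z v
    rw [SimpleGraph.reachable_iff_reflTransGen] at h1
    induction h1 with
    | refl => exact hz
    | tail _ hab ih =>
      rcases (SimpleGraph.fromRel_adj _ _ _).1 hab with ⟨-, h2 | h2⟩
      · exact (hZ _ _ (congrArg some h2)).1 ih
      · exact (hZ _ _ (congrArg some h2)).2 ih

theorem loadPoly_primeForest_of_not_acyclic {V : Type} [Fintype V] {g : V → Option V}
    (hg : ¬ Acyclic g) : loadPoly (PrimeForest g) = 0 := by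
  rw [loadPoly, sum_eq_zero]
  intro c hc
  exact absurd ((mem_loads fun _ h => h.sum_le).1 hc).1 hg

/-- A connected acyclic net has a single root, so only one colour is chosen. -/
theorem totalConnected_forestWeight (a : ℕ) (V : Type) [Fintype V] :
    totalConnected (forestWeight a) V = a * totalConnected (forestWeight 1) V := by
  classical
  rw [totalConnected, totalConnected, mul_sum]
  refine sum_congr rfl fun g hg => ?_
  simp only [forestWeight, Nat.cast_one, one_pow, one_mul]
  by_cases h : Acyclic g
  · rw [h.isConnected_iff.1 (mem_filter.1 hg).2, pow_one]
  · rw [loadPoly_primeForest_of_not_acyclic h, mul_zero, mul_zero]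

/-- Each root of the prime forest is free to choose its image, and these $|V|$ choices act as
colours of its tree. -/
theorem total_mappingWeight (V : Type) [Fintype V] :
    total mappingWeight V = total (forestWeight (Fintype.card V)) V := by
  classical
  have h1 := sum_loadPoly_parkable {h : V → Option V | ∀ v, h v ≠ none}
  rw [sum_filter] at h1
  refine (Eq.trans ?_ h1).trans (sum_congr rfl fun g _ => ?_)
  · refine sum_congr rfl fun g _ => ?_
    simp only [mappingWeight]
  simp only [forestWeight]
  rw [filter_filter, ← Nat.cast_pow, ← card_extends_total g]

/-- A forest extends to $|V|$ times as many mappings as trees, whatever its number of roots. -/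
theorem card_mul_sum_trees (V : Type) [Fintype V] [Nonempty V] :
    (Fintype.card V : Polynomial ℚ) * ∑ h ∈ trees V, loadPoly (Parkable h)
      = total mappingWeight V := by
  classical
  rw [total_mappingWeight, sum_loadPoly_parkable, mul_sum]
  refine sum_congr rfl fun g _ => ?_
  simp only [forestWeight]
  rw [← mul_assoc]
  by_cases h : Acyclic g
  · rw [← Nat.cast_pow, ← card_mul_card_extends_trees h, Nat.cast_mul]
  · rw [loadPoly_primeForest_of_not_acyclic h, mul_zero, mul_zero]

/-! ### The generating functions -/

section GeneratingFunctions

open ParkingSeries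

theorem card_parkingFunctions {V X : Type} [Fintype V] [DecidableEq V] [Finite X] {m : ℕ}
    {φ : X → V → Option V} (hφ : Function.Injective φ) {q : X → Prop}
    {H : Finset (V → Option V)} (hH : ∀ h, h ∈ H ↔ ∃ x, q x ∧ φ x = h) :
    Nat.card {p : X × (Fin m → V) // q p.1 ∧ IsParkingFunction (φ p.1) p.2}
      = ∑ h ∈ H, Nat.card {s : Fin m → V // Parkable h (load s)} := by
  classical
  have := Fintype.ofFinite X
  rw [Nat.card_eq_fintype_card, Fintype.card_subtype,
    card_eq_sum_card_fiberwise (f := fun p => φ p.1) (t := H)]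
  · refine sum_congr rfl fun h hh => ?_
    obtain ⟨x, hx, rfl⟩ := (hH h).1 hh
    rw [Nat.card_eq_fintype_card, Fintype.card_subtype]
    refine card_nbij' Prod.snd (fun s => (x, s)) ?_ ?_ ?_ ?_
    · intro p hp
      simp only [coe_filter, mem_filter, mem_univ, true_and, Set.mem_ofPred_eq,
        isParkingFunction_iff] at hp ⊢
      rw [← hp.2]
      exact hp.1.2
    · intro s hs
      simp only [coe_filter, mem_filter, mem_univ, true_and, Set.mem_ofPred_eq,
        isParkingFunction_iff] at hs ⊢
      exact ⟨⟨hx, hs⟩, trivial⟩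
    · intro p hp
      simp only [coe_filter, mem_filter, Set.mem_ofPred_eq] at hp
      exact Prod.ext (hφ hp.2).symm rfl
    · intro s _
      rfl
  · intro p hp
    simp only [coe_filter, mem_univ, true_and, Set.mem_ofPred_eq] at hp
    exact (hH _).2 ⟨p.1, hp.1, rfl⟩

theorem parkingGF_eq_egf {n₀ : ℕ} {N : ℕ → ℕ → ℕ} (H : ∀ n, Finset (Fin n → Option (Fin n)))
    (h0 : ∀ n < n₀, H n = ∅)
    (hN : ∀ n m, N n m = ∑ h ∈ H n, Nat.card {s : Fin m → Fin n // Parkable h (load s)}) :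
    parkingGF n₀ N = egf fun n => ∑ h ∈ H n, loadPoly (Parkable h) := by
  ext d
  rw [coeff_egf, Polynomial.finsetSum_coeff]
  change (if n₀ ≤ d 0 ∧ d 1 ≤ d 0 then
    (N (d 0) (d 0 - d 1) : ℚ) / ((d 0).factorial * (d 0 - d 1).factorial) else 0) = _
  split_ifs with hd
  · have h1 : ((d 0 - d 1).factorial : ℚ) ≠ 0 := by exact_mod_cast Nat.factorial_ne_zero _
    have h2 : (N (d 0) (d 0 - d 1) : ℚ)
        = (d 0 - d 1).factorial * ∑ h ∈ H (d 0), (loadPoly (Parkable h)).coeff (d 1) := by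
      rw [hN, mul_sum]
      push_cast
      refine sum_congr rfl fun h _ => ?_
      have := coeff_loadPoly (P := Parkable h) (fun _ h => h.sum_le) (k := d 1) (by simpa using hd.2)
      rw [Fintype.card_fin] at this
      exact this.symm
    rw [h2, mul_comm ((d 0).factorial : ℚ), mul_div_mul_left _ _ h1]
  · rcases not_and_or.1 hd with h1 | h1
    · rw [h0 _ (not_le.1 h1), sum_empty, zero_div]
    · rw [sum_eq_zero, zero_div]
      exact fun h _ => coeff_loadPoly_of_lt (by simpa using h1)

theorem some_comp_injective (V : Type) :
    Function.Injective fun (f : V → V) (v : V) => some (f v) := fun _ _ h =>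
  funext fun v => Option.some.inj (congrFun h v)

theorem exists_eq_some_comp {V : Type} {h : V → Option V} (hh : ∀ v, h v ≠ none) :
    ∃ f : V → V, (fun v => some (f v)) = h := by
  choose f hf using fun v => Option.ne_none_iff_exists'.1 (hh v)
  exact ⟨f, funext fun v => (hf v).symm⟩

theorem mappingGF_eq : mappingGF = egf fun n => total mappingWeight (Fin n) := by
  classical
  rw [mappingGF, parkingGF_eq_egf (fun n => {h : Fin n → Option (Fin n) | ∀ v, h v ≠ none})]
  · congr 1
    funext n
    rw [sum_filter, total]
    exact sum_congr (by ext; simp) fun g _ => by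
      simp only [mappingWeight]
      congr
  · simp
  · intro n m
    rw [← card_parkingFunctions (some_comp_injective (Fin n)) (q := fun _ => True)]
    · simp only [true_and]
      rfl
    · intro h
      rw [mem_filter_univ]
      constructor
      · intro hh
        obtain ⟨f, hf⟩ := exists_eq_some_comp hh
        exact ⟨f, trivial, hf⟩
      · rintro ⟨f, -, rfl⟩ v
        simp

theorem connectedGF_eq : connectedGF = egf fun n => totalConnected mappingWeight (Fin n) := by
  classical
  rw [connectedGF, parkingGF_eq_egf
    (fun n => {h : Fin n → Option (Fin n) | IsConnected h ∧ ∀ v, h v ≠ none})]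
  · congr 1
    funext n
    rw [← filter_filter, sum_filter, totalConnected]
    exact sum_congr (by ext; simp) fun g _ => by
      simp only [mappingWeight]
      congr
  · intro n hn
    obtain rfl := Nat.lt_one_iff.1 hn
    rw [filter_eq_empty_iff]
    rintro h - ⟨⟨⟨v⟩, -⟩, -⟩
    exact v.elim0
  · intro n m
    rw [← card_parkingFunctions (some_comp_injective (Fin n)) (q := IsConnectedMapping)]
    · rfl
    · intro h
      rw [mem_filter_univ]
      constructor
      · rintro ⟨hc, hh⟩
        obtain ⟨f, rfl⟩ := exists_eq_some_comp hh
        exact ⟨f, (isConnected_some_iff f).1 hc, rfl⟩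
      · rintro ⟨f, hf, rfl⟩
        exact ⟨(isConnected_some_iff f).2 hf, by simp⟩

theorem cayleyTree_parent_injective (V : Type) :
    Function.Injective (CayleyTree.parent : CayleyTree V → V → Option V) := by
  rintro ⟨r, p, h1, h2⟩ ⟨r', p', h1', h2'⟩ (rfl : p = p')
  obtain rfl : r = r' := (h1' r).1 ((h1 r).2 rfl)
  rfl

theorem mem_trees_iff_exists_cayleyTree {V : Type} [Fintype V] {h : V → Option V} :
    h ∈ trees V ↔ ∃ T : CayleyTree V, T.parent = h := by
  rw [mem_trees]
  constructor
  · rintro ⟨hh, hr⟩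
    obtain ⟨ρ, hρr, -, -, hρ⟩ := hh.exists_root
    obtain ⟨r, hr⟩ := card_eq_one.1 hr
    have h1 : ∀ v, h v = none ↔ v = r := fun v => by
      rw [← mem_roots, hr, mem_singleton]
    exact ⟨⟨r, h, h1, fun v => (h1 _).1 (hρr v) ▸ hρ v⟩, rfl⟩
  · rintro ⟨T, rfl⟩
    constructor
    · intro Z hZ
      by_contra hne
      obtain ⟨v, hv⟩ := Set.nonempty_iff_ne_empty.2 hne
      have h1 : ∀ r, Relation.ReflTransGen (fun a b => T.parent a = some b) v r → r ∈ Z := by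
        intro r hvr
        induction hvr with
        | refl => exact hv
        | tail _ hab ih =>
          obtain ⟨w, hw, haw⟩ := hZ _ ih
          rw [hab] at haw
          exact Option.some.inj haw ▸ hw
      obtain ⟨w, -, hw⟩ := hZ _ (h1 _ (T.path_to_root v))
      rw [(T.parent_eq_none_iff _).2 rfl] at hw
      exact absurd hw (by simp)
    · refine card_eq_one.2 ⟨T.root, ?_⟩
      ext v
      rw [mem_roots, mem_singleton, T.parent_eq_none_iff]

theorem treeGF_eq : treeGF = egf fun n => ∑ h ∈ trees (Fin n), loadPoly (Parkable h) := by
  rw [treeGF, parkingGF_eq_egf fun n => trees (Fin n)]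
  · intro n hn
    obtain rfl := Nat.lt_one_iff.1 hn
    refine eq_empty_of_forall_notMem fun h hh => ?_
    obtain ⟨T, -⟩ := mem_trees_iff_exists_cayleyTree.1 hh
    exact T.root.elim0
  · intro n m
    rw [← card_parkingFunctions (cayleyTree_parent_injective (Fin n)) (q := fun _ => True)]
    · simp only [true_and]
      rfl
    · intro h
      simp only [true_and]
      exact mem_trees_iff_exists_cayleyTree

theorem total_of_isEmpty {ω : ∀ {V : Type} [Fintype V], (V → Option V) → Polynomial ℚ}
    (hω : IsMultiplicative ω) : total ω (Fin 0) = 1 := by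
  rw [total, Fintype.sum_unique]
  exact hω.empty _

theorem totalConnected_of_isEmpty
    (ω : ∀ {V : Type} [Fintype V], (V → Option V) → Polynomial ℚ) :
    totalConnected ω (Fin 0) = 0 := by
  classical
  rw [totalConnected, sum_eq_zero]
  intro g hg
  obtain ⟨⟨v⟩, -⟩ := (mem_filter.1 hg).2
  exact v.elim0

theorem theta_treeGF : theta treeGF = mappingGF - 1 := by
  rw [treeGF_eq, mappingGF_eq, theta_egf]
  ext d
  rw [map_sub, coeff_egf, coeff_egf]
  rcases Nat.eq_zero_or_pos (d 0) with h0 | h0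
  · have := zVar_dvd_iff.1 (zVar_dvd_egf_sub_one (h := fun n => total mappingWeight (Fin n))
      (total_of_isEmpty isMultiplicative_mappingWeight)) d h0
    rw [map_sub, coeff_egf] at this
    rw [this, h0]
    simp
  · have : Nonempty (Fin (d 0)) := ⟨⟨0, h0⟩⟩
    have h1 := card_mul_sum_trees (Fin (d 0))
    rw [Fintype.card_fin] at h1
    have h2 : d ≠ 0 := by
      rintro rfl
      exact lt_irrefl _ h0
    classical
    rw [h1, MvPowerSeries.coeff_one, if_neg h2, sub_zero]

/-- The generating function of prime trees, the trees of a prime forest. -/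
noncomputable def primeGF : Series := egf fun n => totalConnected (forestWeight 1) (Fin n)

/-- The generating function of prime forests. -/
noncomputable def forestGF : Series := egf fun n => total (forestWeight 1) (Fin n)

theorem theta_forestGF : theta forestGF = theta primeGF * forestGF :=
  theta_egf_total (isMultiplicative_forestWeight 1)

theorem zVar_dvd_forestGF_sub_one : zVar ∣ forestGF - 1 :=
  zVar_dvd_egf_sub_one (total_of_isEmpty (isMultiplicative_forestWeight 1))

/-- Colouring multiplies the series of connected nets by $a$; both sides solve $\theta Y=a\,\theta
B\cdot Y$, where $B$ is `primeGF`. -/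
theorem egf_forestWeight (a : ℕ) :
    egf (fun n => total (forestWeight a) (Fin n)) = forestGF ^ a := by
  have h1 : egf (fun n => totalConnected (forestWeight a) (Fin n)) = a * primeGF := by
    ext d
    rw [coeff_egf, totalConnected_forestWeight, Polynomial.coeff_natCast_mul, ← nsmul_eq_mul a primeGF,
      map_nsmul, primeGF, coeff_egf, nsmul_eq_mul, mul_div_assoc]
  have h2 : theta ((a : Series) * primeGF) = a * theta primeGF := by
    rw [← nsmul_eq_mul, map_nsmul, nsmul_eq_mul]
  refine eq_of_theta_eq_mul ((zVar_dvd_theta primeGF).mul_left (a : Series)) ?_ ?_ ?_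
  · have h3 := zVar_dvd_egf_sub_one (h := fun n => total (forestWeight a) (Fin n))
      (total_of_isEmpty (isMultiplicative_forestWeight a))
    have h4 : zVar ∣ forestGF ^ a - 1 := by
      have := sub_dvd_pow_sub_pow forestGF 1 a
      rw [one_pow] at this
      exact zVar_dvd_forestGF_sub_one.trans this
    simpa using dvd_sub h3 h4
  · rw [theta_egf_total (isMultiplicative_forestWeight a), h1, h2]
  · rw [Derivation.leibniz_pow, theta_forestGF]
    cases a with
    | zero => simp
    | succ a =>
      simp only [Nat.add_sub_cancel, smul_eq_mul, nsmul_eq_mul, pow_succ]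
      ring

/-- The number of colours equals the number of nodes, so the power of `forestGF` varies with the
coefficient that is read off. -/
theorem mappingGF_eq_diagonalTransform : mappingGF = diagonalTransform forestGF 1 := by
  ext d
  rw [coeff_diagonalTransform, one_mul, ← egf_forestWeight, mappingGF_eq, coeff_egf, coeff_egf,
    total_mappingWeight, Fintype.card_fin]

theorem theta_mappingGF : theta mappingGF = theta connectedGF * mappingGF := by
  rw [mappingGF_eq, connectedGF_eq]
  exact theta_egf_total isMultiplicative_mappingWeight

end GeneratingFunctions

end RoadNet

/-! ### Cutting and joining prime trees -/

namespace RoadNet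

open Finset

/-- There is a positive flow through each edge, and in the end each node keeps one car. -/
def IsPrimeFlow {V : Type} [Fintype V] (g : V → Option V) (c x : V → ℕ) : Prop :=
  (∀ v, x v = 0 ↔ g v = none) ∧ ∀ v, x v + 1 = c v + inflow g x v

/-- The net is a rooted tree that has a prime flow. -/
def PrimeTree {V : Type} [Fintype V] (g : V → Option V) (c : V → ℕ) : Prop :=
  Acyclic g ∧ #(roots g) = 1 ∧ ∃ x, IsPrimeFlow g c x

/-- The load vector with one more car at `a`. -/
def addCar {V : Type} [DecidableEq V] (c : V → ℕ) (a v : V) : ℕ := c v + if v = a then 1 else 0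

/-- `b` can be reached from `a`. -/
abbrev Reaches {V : Type} (g : V → Option V) (a b : V) : Prop :=
  Relation.ReflTransGen (fun a b => g a = some b) a b

section PrimeTree

variable {V : Type} [Fintype V] {g : V → Option V} {c x : V → ℕ}

theorem sum_inflow_eq [DecidableEq V] (g : V → Option V) (x : V → ℕ) :
    ∑ v, inflow g x v + ∑ v ∈ roots g, x v = ∑ v, x v := by
  have h1 : ∀ v, inflow g x v = inflow g (fun v => if v ∈ roots g then 0 else x v) v := fun v =>
    sum_congr rfl fun w _ => by
      by_cases hw : w ∈ roots g
      · rw [mem_roots] at hw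
        simp [hw]
      · simp only [if_neg hw]
        congr
  rw [sum_congr rfl fun v _ => h1 v, sum_inflow g _ fun v hv => if_pos (mem_roots.2 hv)]
  have h2 : ∑ v ∈ roots g, x v = ∑ v, if v ∈ roots g then x v else 0 := by
    rw [sum_ite_mem, univ_inter]
  rw [h2, ← sum_add_distrib]
  exact sum_congr rfl fun v _ => by split_ifs <;> simp

theorem IsPrimeFlow.sum_eq (h : IsPrimeFlow g c x) : ∑ v, c v = Fintype.card V := by
  classical
  have h1 := sum_congr (rfl : (univ : Finset V) = univ) fun v _ => h.2 v
  rw [sum_add_distrib, sum_add_distrib, sum_inflow g x fun v => (h.1 v).2] at h1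
  simp at h1
  omega

theorem PrimeTree.sum_eq (h : PrimeTree g c) : ∑ v, c v = Fintype.card V := by
  obtain ⟨-, -, x, hx⟩ := h
  exact hx.sum_eq

theorem IsPrimeFlow.unique {y : V → ℕ} (hg : Acyclic g) (hx : IsPrimeFlow g c x)
    (hy : IsPrimeFlow g c y) : x = y := by
  have key : ∀ {x y : V → ℕ}, IsPrimeFlow g c x → IsPrimeFlow g c y → x ≤ y := fun hx hy =>
    flow_le_of_extends (c := c) hg (fun _ => Or.inr rfl) hx.1
      (fun v => by have := hx.2 v; omega) fun v => (hy.2 v).ge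
  exact le_antisymm (key hx hy) (key hy hx)

/-- A node that sees no car has no outflow, so it is a root, and no predecessor either, since every
edge carries cars. By connectedness it is the whole tree. -/
theorem primeForest_iff (hg : Acyclic g) (hr : #(roots g) = 1) :
    PrimeForest g c ↔ PrimeTree g c ∨ (c = 0 ∧ Fintype.card V = 1) := by
  constructor
  · rintro ⟨-, x, hx0, hx⟩
    by_cases h : ∀ v, c v + inflow g x v ≠ 0
    · refine Or.inl ⟨hg, hr, x, hx0, fun v => ?_⟩
      have := hx v
      have := h v
      omega
    · push Not at h
      obtain ⟨r, h⟩ := h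
      obtain ⟨h1, h2⟩ := Nat.add_eq_zero_iff.1 h
      have hgr : g r = none := (hx0 r).1 (by rw [hx, h])
      have h3 : ∀ v, v ∈ ({r} : Set V) := by
        refine (hg.isConnected_iff.2 hr).2 _ (fun v w hvw => ?_) ⟨r, rfl⟩
        rw [Set.mem_singleton_iff, Set.mem_singleton_iff]
        constructor
        · rintro rfl
          rw [hgr] at hvw
          exact absurd hvw (by simp)
        · rintro rfl
          have h4 := le_inflow g (x := x) hvw
          rw [h2, Nat.le_zero, hx0, hvw] at h4
          exact absurd h4 (by simp)
      refine Or.inr ⟨funext fun v => ?_, Fintype.card_eq_one_iff.2 ⟨r, h3⟩⟩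
      rw [h3 v, h1, Pi.zero_apply]
  · rintro (⟨-, -, x, hx⟩ | ⟨rfl, h1⟩)
    · refine ⟨hg, x, hx.1, fun v => ?_⟩
      have := hx.2 v
      omega
    · have h2 : roots g = univ := eq_univ_of_card _ (hr.trans h1.symm)
      refine ⟨hg, 0, fun v => ?_, fun v => ?_⟩
      · simp [← mem_roots, h2]
      · simp [inflow_zero]

end PrimeTree

section Path

variable {V : Type} [Fintype V] [DecidableEq V] {g : V → Option V}

/-- The number of passages of a car starting at `a₀`. -/
theorem exists_path (hg : Acyclic g) (a₀ : V) :
    ∃ t : V → ℕ, (∀ a, t a = (if a = a₀ then 1 else 0) + inflow g t a) ∧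
      (∀ a, t a ≠ 0 → Reaches g a₀ a) ∧ ∑ a ∈ roots g, t a = 1 ∧ ∀ a, t a ≤ 1 := by
  have h1 : ∀ a₀, ∃ t : V → ℕ, (∀ a, t a = (if a = a₀ then 1 else 0) + inflow g t a) ∧
      ∀ a, t a ≠ 0 → Reaches g a₀ a := by
    refine hg.induction fun a₀ ih => ?_
    have h2 : ∀ a, (Pi.single a₀ 1 : V → ℕ) a ≠ 0 → Reaches g a₀ a := fun a ha => by
      rw [Pi.single_apply] at ha
      split_ifs at ha with h
      · rw [h]
      · exact absurd rfl ha
    cases ha₀ : g a₀ with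
    | none =>
      refine ⟨Pi.single a₀ 1, fun a => ?_, h2⟩
      rw [inflow_single, Pi.single_apply]
      simp [ha₀]
    | some w =>
      obtain ⟨t, ht, htr⟩ := ih w ha₀
      refine ⟨Pi.single a₀ 1 + t, fun a => ?_, fun a ha => ?_⟩
      · rw [inflow_add, inflow_single_of_eq g ha₀, Pi.add_apply, ht a, Pi.single_apply,
          Pi.single_apply]
      · by_cases hta : t a = 0
        · exact h2 a (by simpa [hta] using ha)
        · exact .head ha₀ (htr a hta)
  obtain ⟨t, ht, htr⟩ := h1 a₀
  have h2 : ∑ a ∈ roots g, t a = 1 := by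
    have h3 := sum_inflow_eq g t
    have h4 : ∑ a, t a = ∑ a, ((if a = a₀ then 1 else 0) + inflow g t a) :=
      sum_congr rfl fun a _ => ht a
    rw [sum_add_distrib, sum_ite_eq' univ a₀, if_pos (mem_univ _)] at h4
    omega
  refine ⟨t, ht, htr, h2, hg.induction fun a ih => ?_⟩
  cases ha : g a with
  | none => exact h2 ▸ single_le_sum (fun _ _ => Nat.zero_le _) (mem_roots.2 ha)
  | some w =>
    have h3 := le_inflow g (x := t) ha
    have h4 := ih w ha
    have h5 := ht w
    omega

theorem one_le_of_reaches {a₀ : V} {t : V → ℕ}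
    (ht : ∀ a, t a = (if a = a₀ then 1 else 0) + inflow g t a) {a : V} (h : Reaches g a₀ a) :
    1 ≤ t a := by
  induction h with
  | refl => rw [ht, if_pos rfl]; omega
  | tail _ hab ih => exact (ih.trans (le_inflow g hab)).trans (by rw [ht]; omega)

end Path

/-- The net in which the roots of `g₁` are attached to the node `b₀` of `g₂`. -/
def join {A B V : Type} (e : A ⊕ B ≃ V) (g₁ : A → Option A) (g₂ : B → Option B) (b₀ : B) (v : V) :
    Option V :=
  Sum.elim (fun a => some ((g₁ a).elim (e (Sum.inr b₀)) fun a' => e (Sum.inl a')))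
    (fun b => (g₂ b).map fun b' => e (Sum.inr b')) (e.symm v)

section Join

variable {A B V : Type} {e : A ⊕ B ≃ V} {g₁ : A → Option A} {g₂ : B → Option B} {b₀ : B}

theorem join_inl (a : A) : join e g₁ g₂ b₀ (e (Sum.inl a))
    = some ((g₁ a).elim (e (Sum.inr b₀)) fun a' => e (Sum.inl a')) := by simp [join]

theorem join_inl_of_none {a : A} (h : g₁ a = none) :
    join e g₁ g₂ b₀ (e (Sum.inl a)) = some (e (Sum.inr b₀)) := by simp [join_inl, h]

theorem join_inl_of_some {a a' : A} (h : g₁ a = some a') :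
    join e g₁ g₂ b₀ (e (Sum.inl a)) = some (e (Sum.inl a')) := by simp [join_inl, h]

theorem join_inr (b : B) : join e g₁ g₂ b₀ (e (Sum.inr b))
    = (g₂ b).map fun b' => e (Sum.inr b') := by simp [join]

theorem join_inl_eq_inl {a a' : A} :
    join e g₁ g₂ b₀ (e (Sum.inl a)) = some (e (Sum.inl a')) ↔ g₁ a = some a' := by
  cases h : g₁ a with
  | none => simp [join_inl_of_none h]
  | some w => simp [join_inl_of_some h]

theorem join_inl_eq_inr {a : A} {b : B} :
    join e g₁ g₂ b₀ (e (Sum.inl a)) = some (e (Sum.inr b)) ↔ g₁ a = none ∧ b₀ = b := by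
  cases h : g₁ a with
  | none => simp [join_inl_of_none h]
  | some w => simp [join_inl_of_some h]

theorem join_inr_eq_inr {b b' : B} :
    join e g₁ g₂ b₀ (e (Sum.inr b)) = some (e (Sum.inr b')) ↔ g₂ b = some b' := by
  rw [join_inr, Option.map_eq_some_iff]
  simp

theorem join_inr_ne_inl {b : B} {a : A} :
    join e g₁ g₂ b₀ (e (Sum.inr b)) ≠ some (e (Sum.inl a)) := by
  rw [join_inr, Ne, Option.map_eq_some_iff]
  simp

theorem join_inr_eq_none {b : B} : join e g₁ g₂ b₀ (e (Sum.inr b)) = none ↔ g₂ b = none := by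
  rw [join_inr, Option.map_eq_none_iff]

theorem acyclic_join : Acyclic (join e g₁ g₂ b₀) ↔ Acyclic g₁ ∧ Acyclic g₂ := by
  constructor
  · intro h
    constructor
    · intro Z hZ
      have := h ((fun a => e (Sum.inl a)) '' Z) (by
        rintro _ ⟨a, ha, rfl⟩
        obtain ⟨a', ha', h1⟩ := hZ a ha
        exact ⟨_, ⟨a', ha', rfl⟩, join_inl_of_some h1⟩)
      exact Set.image_eq_empty.1 this
    · intro Z hZ
      have := h ((fun b => e (Sum.inr b)) '' Z) (by
        rintro _ ⟨b, hb, rfl⟩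
        obtain ⟨b', hb', h1⟩ := hZ b hb
        exact ⟨_, ⟨b', hb', rfl⟩, join_inr_eq_inr.2 h1⟩)
      exact Set.image_eq_empty.1 this
  · rintro ⟨h1, h2⟩ Z hZ
    have h4 := h2 {b | e (Sum.inr b) ∈ Z} fun b hb => by
      obtain ⟨w, hw, hbw⟩ := hZ _ hb
      rw [join_inr, Option.map_eq_some_iff] at hbw
      obtain ⟨b', hb', rfl⟩ := hbw
      exact ⟨b', hw, hb'⟩
    rw [Set.eq_empty_iff_forall_notMem] at h4
    have h3 := h1 {a | e (Sum.inl a) ∈ Z} fun a ha => by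
      obtain ⟨w, hw, haw⟩ := hZ _ ha
      cases h5 : g₁ a with
      | none =>
        rw [join_inl_of_none h5] at haw
        obtain rfl := Option.some.inj haw
        exact absurd hw (h4 b₀)
      | some a' =>
        rw [join_inl_of_some h5] at haw
        obtain rfl := Option.some.inj haw
        exact ⟨a', hw, rfl⟩
    rw [Set.eq_empty_iff_forall_notMem] at h3 ⊢
    exact forall_equiv_sum.2 ⟨h3, h4⟩

theorem join_injective {g₁' : A → Option A} {g₂' : B → Option B} {b₀' : B}
    (h : join e g₁ g₂ b₀ = join e g₁' g₂' b₀') {a : A} (ha : g₁ a = none) :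
    g₁ = g₁' ∧ g₂ = g₂' ∧ b₀ = b₀' := by
  refine ⟨funext fun a => ?_, funext fun b => ?_, ?_⟩
  · refine Option.ext fun a' => ?_
    rw [← join_inl_eq_inl (e := e) (g₂ := g₂) (b₀ := b₀), h, join_inl_eq_inl]
  · refine Option.ext fun b' => ?_
    rw [← join_inr_eq_inr (e := e) (g₁ := g₁) (b₀ := b₀), h, join_inr_eq_inr]
  · have h1 := join_inl_of_none (e := e) (g₂ := g₂) (b₀ := b₀) ha
    rw [h, join_inl_eq_inr] at h1
    exact h1.2.symm

theorem reaches_join_inl {a a' : A} (h : Reaches g₁ a a') :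
    Reaches (join e g₁ g₂ b₀) (e (Sum.inl a)) (e (Sum.inl a')) := by
  induction h with
  | refl => exact .refl
  | tail _ hab ih => exact ih.tail (join_inl_of_some hab)

theorem reaches_of_join_inl {a a' : A}
    (h : Reaches (join e g₁ g₂ b₀) (e (Sum.inl a)) (e (Sum.inl a'))) : Reaches g₁ a a' := by
  generalize hv : e (Sum.inl a') = v at h
  induction h generalizing a' with
  | refl =>
    obtain rfl := Sum.inl_injective (e.injective hv)
    exact .refl
  | @tail u w _ huw ih =>
    subst hv
    obtain ⟨y, rfl⟩ := e.surjective u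
    rcases y with a'' | b
    · exact (ih rfl).tail (join_inl_eq_inl.1 huw)
    · exact absurd huw join_inr_ne_inl

variable [Fintype A] [Fintype B] [Fintype V]

theorem card_roots_join : #(roots (join e g₁ g₂ b₀)) = #(roots g₂) := by
  classical
  simp only [roots, card_filter]
  rw [← e.sum_comp, Fintype.sum_sum_type]
  simp [join_inl, join_inr]

theorem inflow_join_inl (x : V → ℕ) (a : A) : inflow (join e g₁ g₂ b₀) x (e (Sum.inl a))
    = inflow g₁ (fun a => x (e (Sum.inl a))) a := by
  classical
  rw [inflow, inflow, ← e.sum_comp, Fintype.sum_sum_type]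
  refine (congrArg₂ (· + ·) ?_ ?_).trans (add_zero _)
  · exact sum_congr rfl fun w _ => if_congr join_inl_eq_inl rfl rfl
  · exact sum_eq_zero fun w _ => if_neg join_inr_ne_inl

theorem inflow_join_inr [DecidableEq B] (x : V → ℕ) (b : B) :
    inflow (join e g₁ g₂ b₀) x (e (Sum.inr b))
      = inflow g₂ (fun b => x (e (Sum.inr b))) b
        + if b = b₀ then ∑ a ∈ roots g₁, x (e (Sum.inl a)) else 0 := by
  classical
  rw [inflow, inflow, ← e.sum_comp, Fintype.sum_sum_type, add_comm]
  congr 1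
  · refine sum_congr rfl fun w _ => ?_
    simp only [join_inr_eq_inr]
    congr
  · simp only [join_inl_eq_inr]
    split_ifs with hb
    · simp [hb, roots, sum_filter]
    · simp [Ne.symm hb]

end Join

end RoadNet

/-! ### The cut of a prime tree with a marked car, and its inverse -/

namespace RoadNet

open Finset

/-- The first node `r` on the path from `e₀` that is left by exactly one car is the last node
of `A`, which consists of `r` and all nodes above. -/
structure IsCut {V : Type} (g : V → Option V) (x : V → ℕ) (e₀ : V) (A : Set V) (r : V) :
    Prop where
  start_mem : e₀ ∈ A
  mem : r ∈ A
  flow : x r = 1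
  exit : ∃ p, p ∉ A ∧ g r = some p
  stay : ∀ v ∈ A, v ≠ r → ∃ w ∈ A, g v = some w
  outside : ∀ v ∉ A, ∀ w, g v = some w → w ∉ A
  two_le : ∀ v ∈ A, Reaches g e₀ v → v ≠ r → 2 ≤ x v

/-- Along the path from $e_0$ the flow is at least $2$ before the cut node and $1$ there, so $r=r'$.
Then `stay` and `outside` force both sets to consist of the nodes leading to $r$. -/
theorem IsCut.unique {V : Type} {g : V → Option V} {x : V → ℕ} {e₀ : V} {A A' : Set V} {r r' : V}
    (hg : Acyclic g) (h : IsCut g x e₀ A r) (h' : IsCut g x e₀ A' r') : A = A' := by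
  have hr : ∀ v, v ∈ A → v ∈ A' → Reaches g e₀ v → r = r' := by
    refine hg.induction fun v ih hv hv' hev => ?_
    by_cases h1 : v = r
    · by_contra hne
      have := h'.two_le v hv' hev fun h2 => hne (h1.symm.trans h2)
      rw [h1, h.flow] at this
      omega
    · obtain ⟨w, hw, hvw⟩ := h.stay v hv h1
      have h2 : v ≠ r' := by
        rintro rfl
        have := h.two_le v hv hev h1
        rw [h'.flow] at this
        omega
      obtain ⟨w', hw', hvw'⟩ := h'.stay v hv' h2
      obtain rfl : w = w' := Option.some.inj (hvw.symm.trans hvw')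
      exact ih w hvw hw hw' (hev.tail hvw)
  obtain rfl := hr e₀ h.start_mem h'.start_mem .refl
  have key : ∀ {A A' : Set V}, IsCut g x e₀ A r → IsCut g x e₀ A' r → ∀ v, v ∈ A → v ∈ A' := by
    intro A A' h h'
    refine hg.induction fun v ih hv => ?_
    by_cases h1 : v = r
    · exact h1 ▸ h'.mem
    · obtain ⟨w, hw, hvw⟩ := h.stay v hv h1
      by_contra h2
      exact h'.outside v h2 w hvw (ih w hvw hw)
  exact Set.Subset.antisymm (key h h') (key h' h)

/-- The root sees exactly one car, so the last edge of the path from $e_0$ carries flow $1$, and a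
first such edge exists. -/
theorem exists_isCut {V : Type} [Fintype V] [DecidableEq V] {g : V → Option V} {c x : V → ℕ}
    {e₀ : V} (hg : Acyclic g) (hr : #(roots g) = 1) (hx : IsPrimeFlow g (addCar c e₀) x)
    (hV : 2 ≤ Fintype.card V) : ∃ A r, IsCut g x e₀ A r := by
  obtain ⟨ρ, hρ⟩ := card_eq_one.1 hr
  have hroot : ∀ v, g v = none ↔ v = ρ := fun v => by rw [← mem_roots, hρ, mem_singleton]
  have hin : addCar c e₀ ρ + inflow g x ρ = 1 := by
    rw [← hx.2, (hx.1 ρ).2 ((hroot ρ).2 rfl)]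
  -- If the marked car started at the root, it would be the only car there, so the root would have
  -- no predecessors and be alone, against `hV`.
  have he₀ : e₀ ≠ ρ := by
    rintro rfl
    have h1 : inflow g x e₀ = 0 := by
      rw [addCar, if_pos rfl] at hin
      omega
    have h2 : ∀ v, v ∈ ({e₀} : Set V) := by
      refine (hg.isConnected_iff.2 hr).2 _ (fun v w hvw => ?_) ⟨e₀, rfl⟩
      rw [Set.mem_singleton_iff, Set.mem_singleton_iff]
      constructor
      · rintro rfl
        rw [(hroot v).2 rfl] at hvw
        exact absurd hvw (by simp)
      · rintro rfl
        have h4 := le_inflow g (x := x) hvw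
        rw [h1, Nat.le_zero, hx.1, hvw] at h4
        exact absurd h4 (by simp)
    have h3 := Fintype.card_eq_one_iff.2 ⟨e₀, h2⟩
    omega
  have key : ∀ v, v ≠ ρ → ∃ r, Reaches g v r ∧ r ≠ ρ ∧ x r = 1 ∧
      ∀ w, Reaches g v w → Reaches g w r → w ≠ r → 2 ≤ x w := by
    refine hg.induction fun v ih hv => ?_
    have hv0 : x v ≠ 0 := fun h => hv ((hroot v).1 ((hx.1 v).1 h))
    by_cases h1 : x v = 1
    · refine ⟨v, .refl, hv, h1, fun w hvw hwv hne => ?_⟩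
      exfalso
      obtain ⟨u, hwu, huv⟩ := (Relation.ReflTransGen.cases_head hwv).resolve_left hne
      have h2 := hg {y | Reaches g v y ∧ Reaches g y v} fun y ⟨hy, hy'⟩ => by
        rcases Relation.ReflTransGen.cases_head hy' with rfl | ⟨z, hyz, hzv⟩
        · rcases Relation.ReflTransGen.cases_head hvw with rfl | ⟨z, hyz, hzw⟩
          · exact absurd rfl hne
          · exact ⟨z, ⟨.single hyz, hzw.trans hwv⟩, hyz⟩
        · exact ⟨z, ⟨hy.tail hyz, hzv⟩, hyz⟩
      exact Set.eq_empty_iff_forall_notMem.1 h2 v ⟨.refl, .refl⟩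
    · cases hgv : g v with
      | none => exact absurd ((hroot v).1 hgv) hv
      | some w =>
        -- The flow at $v$ is at least $2$ here, more than the root can receive.
        have hw : w ≠ ρ := by
          rintro rfl
          have := le_inflow g (x := x) hgv
          omega
        obtain ⟨r, hwr, hrρ, hr1, h2⟩ := ih w hgv hw
        refine ⟨r, .head hgv hwr, hrρ, hr1, fun u hvu hur hne => ?_⟩
        rcases Relation.ReflTransGen.cases_head hvu with rfl | ⟨z, hvz, hzu⟩
        · omega
        · rw [hgv] at hvz
          obtain rfl := Option.some.inj hvz
          exact h2 u hzu hur hne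
  obtain ⟨r, her, hrρ, hr1, h2⟩ := key e₀ he₀
  refine ⟨{v | Reaches g v r}, r, her, .refl, hr1, ?_, ?_, ?_, fun v hv hev hne => h2 v hev hv hne⟩
  · cases hgr : g r with
    | none => exact absurd ((hroot r).1 hgr) hrρ
    | some p =>
      refine ⟨p, fun hp => ?_, rfl⟩
      have h3 := hg {y | Reaches g r y ∧ Reaches g y r} fun y ⟨hy, hy'⟩ => by
        rcases Relation.ReflTransGen.cases_head hy' with rfl | ⟨z, hyz, hzr⟩
        · exact ⟨p, ⟨.single hgr, hp⟩, hgr⟩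
        · exact ⟨z, ⟨hy.tail hyz, hzr⟩, hyz⟩
      exact Set.eq_empty_iff_forall_notMem.1 h3 r ⟨.refl, .refl⟩
  · intro v hv hne
    obtain ⟨w, hvw, hwr⟩ := (Relation.ReflTransGen.cases_head hv).resolve_left hne
    exact ⟨w, hwr, hvw⟩
  · intro v hv w hvw hw
    exact hv (.head hvw hw)

section Join

variable {A B V : Type} [Fintype A] [Fintype B] [Fintype V] [DecidableEq A] [DecidableEq B]
  [DecidableEq V] {e : A ⊕ B ≃ V} {g₁ : A → Option A} {g₂ : B → Option B} {b₀ : B}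

omit [Fintype A] [Fintype B] [Fintype V] [DecidableEq B] in
theorem addCar_inl_inl (c : V → ℕ) (a₀ a : A) : addCar c (e (Sum.inl a₀)) (e (Sum.inl a))
    = c (e (Sum.inl a)) + if a = a₀ then 1 else 0 := by simp [addCar]

omit [Fintype A] [Fintype B] [Fintype V] [DecidableEq A] [DecidableEq B] in
theorem addCar_inl_inr (c : V → ℕ) (a₀ : A) (b : B) :
    addCar c (e (Sum.inl a₀)) (e (Sum.inr b)) = c (e (Sum.inr b)) := by simp [addCar]

/-- Superpose the flow of $g_1$ with the path $t$ of one more car from $a_0$. This car leaves the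
root of $g_1$ and arrives at $b_0$ in place of the marked car of $g_2$. On its path in $g_1$ the
flow was already positive except at the root, which makes the joining edge the first one with flow
$1$. -/
theorem primeTree_join {c : V → ℕ} (h₁ : PrimeTree g₁ fun a => c (e (Sum.inl a)))
    (h₂ : PrimeTree g₂ (addCar (fun b => c (e (Sum.inr b))) b₀)) (a₀ : A) :
    PrimeTree (join e g₁ g₂ b₀) (addCar c (e (Sum.inl a₀))) ∧
      ∃ x r, IsPrimeFlow (join e g₁ g₂ b₀) (addCar c (e (Sum.inl a₀))) x ∧
        IsCut (join e g₁ g₂ b₀) x (e (Sum.inl a₀)) {v | ∃ a, e (Sum.inl a) = v} r := by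
  obtain ⟨hg₁, hr₁, x₁, hx₁⟩ := h₁
  obtain ⟨hg₂, hr₂, x₂, hx₂⟩ := h₂
  obtain ⟨t, ht, -, htr, -⟩ := exists_path hg₁ a₀
  obtain ⟨r₁, hr₁⟩ := card_eq_one.1 hr₁
  have hroot : ∀ a, g₁ a = none ↔ a = r₁ := fun a => by rw [← mem_roots, hr₁, mem_singleton]
  rw [hr₁, sum_singleton] at htr
  have hx₁r : x₁ r₁ = 0 := (hx₁.1 r₁).2 ((hroot r₁).2 rfl)
  let x : V → ℕ := fun v => Sum.elim (x₁ + t) x₂ (e.symm v)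
  have hxl : ∀ a, x (e (Sum.inl a)) = x₁ a + t a := fun a => by simp [x]
  have hxr : ∀ b, x (e (Sum.inr b)) = x₂ b := fun b => by simp [x]
  have hflow : IsPrimeFlow (join e g₁ g₂ b₀) (addCar c (e (Sum.inl a₀))) x := by
    constructor
    · rw [forall_equiv_sum (e := e)]
      constructor
      · intro a
        have h1 : x (e (Sum.inl a)) ≠ 0 := by
          rw [hxl]
          rcases eq_or_ne a r₁ with rfl | hne
          · omega
          · have := mt ((hx₁.1 a).1) (mt (hroot a).1 hne)
            omega
        simp [h1, join_inl]
      · intro b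
        rw [hxr, join_inr_eq_none, hx₂.1]
    · rw [forall_equiv_sum (e := e)]
      constructor
      · intro a
        have h1 : (fun a => x (e (Sum.inl a))) = x₁ + t := funext hxl
        rw [inflow_join_inl, h1, inflow_add, hxl, addCar_inl_inl]
        have h2 := hx₁.2 a
        have := ht a
        beta_reduce at h2
        omega
      · intro b
        have h1 : (fun b => x (e (Sum.inr b))) = x₂ := funext hxr
        rw [inflow_join_inr, h1, hxr, hr₁, sum_singleton, hxl, hx₁r, htr, addCar_inl_inr, hx₂.2,
          addCar]
        ring
  refine ⟨⟨acyclic_join.2 ⟨hg₁, hg₂⟩, card_roots_join.trans hr₂, x, hflow⟩, x, e (Sum.inl r₁),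
    hflow, ⟨a₀, rfl⟩, ⟨r₁, rfl⟩, ?_, ⟨e (Sum.inr b₀), ?_, ?_⟩, ?_, ?_, ?_⟩
  · rw [hxl, hx₁r, htr]
  · rintro ⟨a, ha⟩
    exact absurd (e.injective ha) (by simp)
  · exact join_inl_of_none ((hroot r₁).2 rfl)
  · rintro _ ⟨a, rfl⟩ hne
    cases h1 : g₁ a with
    | none => exact absurd (congrArg _ (congrArg _ ((hroot a).1 h1))) hne
    | some a' => exact ⟨_, ⟨a', rfl⟩, join_inl_of_some h1⟩
  · rintro v hv _ hvw ⟨a', rfl⟩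
    obtain ⟨y, rfl⟩ := e.surjective v
    rcases y with a | b
    · exact hv ⟨a, rfl⟩
    · exact join_inr_ne_inl hvw
  · rintro _ ⟨a, rfl⟩ hva hne
    have h1 := one_le_of_reaches ht (reaches_of_join_inl hva)
    have h2 : a ≠ r₁ := fun h => hne (h ▸ rfl)
    have := mt ((hx₁.1 a).1) (mt (hroot a).1 h2)
    rw [hxl]
    omega

theorem exists_join {g : V → Option V} {c x : V → ℕ} {a₀ : A} {r : V} (hg : Acyclic g)
    (hr : #(roots g) = 1) (hx : IsPrimeFlow g (addCar c (e (Sum.inl a₀))) x)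
    (hcut : IsCut g x (e (Sum.inl a₀)) {v | ∃ a, e (Sum.inl a) = v} r) :
    ∃ g₁ g₂ b₀, join e g₁ g₂ b₀ = g ∧ PrimeTree g₁ (fun a => c (e (Sum.inl a))) ∧
      PrimeTree g₂ (addCar (fun b => c (e (Sum.inr b))) b₀) := by
  obtain ⟨r₁, rfl⟩ := hcut.mem
  obtain ⟨p, hp, hrp⟩ := hcut.exit
  obtain ⟨b₀, rfl⟩ : ∃ b₀, e (Sum.inr b₀) = p := by
    obtain ⟨y, rfl⟩ := e.surjective p
    rcases y with a | b
    · exact absurd ⟨a, rfl⟩ hp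
    · exact ⟨b, rfl⟩
  have h1 : ∀ a, ∃ o : Option A, (o = none ↔ a = r₁) ∧
      g (e (Sum.inl a)) = some (o.elim (e (Sum.inr b₀)) fun a' => e (Sum.inl a')) := by
    intro a
    by_cases ha : a = r₁
    · exact ⟨none, by simp [ha], by rw [ha, hrp]; rfl⟩
    · obtain ⟨_, ⟨a', rfl⟩, h2⟩ := hcut.stay _ ⟨a, rfl⟩ fun h => ha (by simpa using h)
      exact ⟨some a', by simp [ha], h2⟩
  have h2 : ∀ b, ∃ o : Option B, (o.map fun b' => e (Sum.inr b')) = g (e (Sum.inr b)) := by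
    intro b
    cases hgb : g (e (Sum.inr b)) with
    | none => exact ⟨none, rfl⟩
    | some w =>
      have h3 := hcut.outside (e (Sum.inr b)) (by rintro ⟨a, ha⟩; simp at ha) w hgb
      obtain ⟨y, rfl⟩ := e.surjective w
      rcases y with a | b'
      · exact absurd ⟨a, rfl⟩ h3
      · exact ⟨some b', rfl⟩
  choose g₁ hroot hg₁ using h1
  choose g₂ hg₂ using h2
  have hjoin : join e g₁ g₂ b₀ = g := by
    funext v
    obtain ⟨y, rfl⟩ := e.surjective v
    rcases y with a | b
    · rw [join_inl, hg₁]
    · rw [join_inr, hg₂]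
  subst hjoin
  obtain ⟨hac₁, hac₂⟩ := acyclic_join.1 hg
  have hr₁ : roots g₁ = {r₁} := by
    ext a
    rw [mem_roots, mem_singleton, hroot]
  obtain ⟨t, ht, htreach, htr, ht1⟩ := exists_path hac₁ a₀
  rw [hr₁, sum_singleton] at htr
  have hx1 : ∀ a, x (e (Sum.inl a)) ≠ 0 := fun a h => by
    have := (hx.1 _).1 h
    rw [join_inl] at this
    exact absurd this (by simp)
  -- Take the marked car out of the upper piece. By `two_le` its other edges stay in use, and only
  -- the cut edge drops to flow $0$.
  let x₁ : A → ℕ := fun a => x (e (Sum.inl a)) - t a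
  have hxt : (fun a => x (e (Sum.inl a))) = x₁ + t := by
    funext a
    have := hx1 a
    have := ht1 a
    simp only [Pi.add_apply, x₁]
    omega
  refine ⟨g₁, g₂, b₀, rfl, ⟨hac₁, by rw [hr₁, card_singleton], x₁, fun a => ?_, fun a => ?_⟩,
    hac₂, card_roots_join.symm.trans hr, fun b => x (e (Sum.inr b)), fun b => ?_, fun b => ?_⟩
  · rw [hroot]
    have h3 := congrFun hxt a
    rw [Pi.add_apply] at h3
    constructor
    · intro h0
      by_contra hne
      have h4 := hx1 a
      have h5 := ht1 a
      have h6 := hcut.two_le _ ⟨a, rfl⟩ (reaches_join_inl (htreach a (by omega)))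
        (fun h => hne (by simpa using h))
      omega
    · rintro rfl
      have := hcut.flow
      omega
  · have h3 := congrFun hxt a
    have h4 := hx.2 (e (Sum.inl a))
    have h5 := ht a
    rw [inflow_join_inl, hxt, inflow_add, addCar_inl_inl] at h4
    rw [Pi.add_apply] at h3
    beta_reduce
    omega
  · rw [hx.1, join_inr_eq_none]
  · rw [hx.2, inflow_join_inr, hr₁, sum_singleton, hcut.flow, addCar_inl_inr, addCar]
    ring

end Join

end RoadNet

/-! ### Counting prime trees -/

namespace RoadNet

open Finset

section Sums

variable (V : Type) [Fintype V]

open Classical in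
/-- The prime trees with their load vectors. -/
noncomputable def primeTrees : Finset ((V → Option V) × (V → ℕ)) :=
  {p ∈ univ ×ˢ Fintype.piFinset fun _ => range (Fintype.card V + 1) | PrimeTree p.1 p.2}

open Classical in
/-- The prime trees in which a car is marked, given by its preferred node. The other cars make up
the load vector. -/
noncomputable def markedPrimeTrees [DecidableEq V] : Finset ((V → Option V) × (V → ℕ) × V) :=
  {p ∈ univ ×ˢ (Fintype.piFinset fun _ => range (Fintype.card V + 1)) ×ˢ univ |
    PrimeTree p.1 (addCar p.2.1 p.2.2)}

/-- The weighted number of prime trees on `V`. -/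
noncomputable def primeSum : ℚ := ∑ p ∈ primeTrees V, loadWeight p.2

variable {V}

theorem mem_primeTrees {p : (V → Option V) × (V → ℕ)} :
    p ∈ primeTrees V ↔ PrimeTree p.1 p.2 := by
  classical
  rw [primeTrees, mem_filter, mem_product, Fintype.mem_piFinset, and_iff_right_iff_imp]
  refine fun h => ⟨mem_univ _, fun v => ?_⟩
  rw [mem_range, Nat.lt_succ_iff, ← h.sum_eq]
  exact single_le_sum (fun _ _ => Nat.zero_le _) (mem_univ v)

variable [DecidableEq V]

theorem mem_markedPrimeTrees {p : (V → Option V) × (V → ℕ) × V} :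
    p ∈ markedPrimeTrees V ↔ PrimeTree p.1 (addCar p.2.1 p.2.2) := by
  classical
  rw [markedPrimeTrees, mem_filter, mem_product, mem_product, Fintype.mem_piFinset,
    and_iff_right_iff_imp]
  refine fun h => ⟨mem_univ _, fun v => ?_, mem_univ _⟩
  rw [mem_range, Nat.lt_succ_iff, ← h.sum_eq]
  exact (Nat.le_add_right _ _).trans
    (single_le_sum (f := addCar p.2.1 p.2.2) (fun _ _ => Nat.zero_le _) (mem_univ v))

/-- With $c$ the load of the unmarked cars, the factor counts the cars preferring $a$ that could be
the marked one. -/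
theorem mul_loadWeight_addCar (c : V → ℕ) (a : V) :
    (addCar c a a : ℚ) * loadWeight (addCar c a) = loadWeight c := by
  rw [loadWeight, loadWeight, ← mul_prod_erase _ _ (mem_univ a), ← mul_prod_erase _ _ (mem_univ a),
    ← mul_assoc]
  congr 1
  · have h1 : ((c a).factorial : ℚ) ≠ 0 := by exact_mod_cast Nat.factorial_ne_zero _
    have h2 : (c a : ℚ) + 1 ≠ 0 := by positivity
    rw [addCar, if_pos rfl, Nat.factorial_succ]
    push_cast
    field_simp
  · refine prod_congr rfl fun v hv => ?_
    rw [addCar, if_neg (ne_of_mem_erase hv), add_zero]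

/-- A prime tree holds as many cars as nodes, so marking a car multiplies the weight by $|V|$, as
marking a node would. -/
theorem sum_markedPrimeTrees :
    ∑ p ∈ markedPrimeTrees V, loadWeight p.2.1 = Fintype.card V * primeSum V := by
  have h1 : (Fintype.card V : ℚ) * primeSum V
      = ∑ p ∈ primeTrees V ×ˢ univ with p.1.2 p.2 ≠ 0, (p.1.2 p.2 : ℚ) * loadWeight p.1.2 := by
    rw [sum_filter_of_ne, primeSum, mul_sum, sum_product]
    swap
    · exact fun p _ h h0 => h (by rw [h0, Nat.cast_zero, zero_mul])
    refine sum_congr rfl fun p hp => ?_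
    dsimp only
    rw [← sum_mul, ← (mem_primeTrees.1 hp).sum_eq, Nat.cast_sum]
  rw [h1]
  have h2 : ∀ (c : V → ℕ) (a : V), c a ≠ 0 →
      addCar (fun v => c v - if v = a then 1 else 0) a = c := fun c a ha => by
    funext v
    rw [addCar]
    split_ifs with h
    · subst h; omega
    · rfl
  refine sum_nbij' (fun p => ((p.1, addCar p.2.1 p.2.2), p.2.2))
    (fun q => (q.1.1, (fun v => q.1.2 v - if v = q.2 then 1 else 0), q.2)) ?_ ?_ ?_ ?_ ?_
  · intro p hp
    rw [mem_filter, mem_product, mem_primeTrees]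
    refine ⟨⟨mem_markedPrimeTrees.1 hp, mem_univ _⟩, ?_⟩
    simp [addCar]
  · intro q hq
    rw [mem_filter, mem_product, mem_primeTrees] at hq
    rw [mem_markedPrimeTrees]
    dsimp only
    rw [h2 _ _ hq.2]
    exact hq.1.1
  · intro p _
    refine Prod.ext rfl (Prod.ext (funext fun v => ?_) rfl)
    simp [addCar]
  · intro q hq
    rw [mem_filter] at hq
    exact Prod.ext (Prod.ext rfl (h2 _ _ hq.2)) rfl
  · intro p _
    exact (mul_loadWeight_addCar _ _).symm

/-- The marked prime tree is cut along the boundary of `A`. -/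
def IsCutAlong (p : (V → Option V) × (V → ℕ) × V) (A : Finset V) : Prop :=
  ∃ x r, IsPrimeFlow p.1 (addCar p.2.1 p.2.2) x ∧ IsCut p.1 x p.2.2 A r

/-- Cutting and joining are inverse: the upper piece keeps the preferred node $a_0$ of the removed
car as a marked node, the lower piece receives a marked car at $b_0$. -/
theorem sum_isCutAlong (A : Finset V) :
    (open Classical in ∑ p ∈ markedPrimeTrees V with IsCutAlong p A, loadWeight p.2.1)
      = (Fintype.card {v // v ∈ A} * primeSum {v // v ∈ A})
        * ∑ p ∈ markedPrimeTrees {v // v ∉ A}, loadWeight p.2.1 := by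
  classical
  let e : {v // v ∈ A} ⊕ {v // v ∉ A} ≃ V := Equiv.sumCompl (· ∈ A)
  have hA : (A : Set V) = {v | ∃ a, e (Sum.inl a) = v} := by
    ext w
    exact ⟨fun hw => ⟨⟨w, hw⟩, rfl⟩, by rintro ⟨a, rfl⟩; exact a.2⟩
  have h1 : (Fintype.card {v // v ∈ A} : ℚ) * primeSum {v // v ∈ A}
      = ∑ p ∈ primeTrees {v // v ∈ A} ×ˢ (univ : Finset {v // v ∈ A}), loadWeight p.1.2 := by
    rw [primeSum, mul_sum, sum_product]
    refine sum_congr rfl fun p _ => ?_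
    dsimp only
    rw [sum_const, card_univ, nsmul_eq_mul]
  rw [h1, sum_mul_sum, ← sum_product']
  symm
  let glueLoad : ({v // v ∈ A} → ℕ) → ({v // v ∉ A} → ℕ) → V → ℕ :=
    fun c₁ c₂ v => Sum.elim c₁ c₂ (e.symm v)
  have hl : ∀ c₁ c₂, (fun a => glueLoad c₁ c₂ (e (Sum.inl a))) = c₁ := fun c₁ c₂ => by
    funext a; simp [glueLoad]
  have hr : ∀ c₁ c₂, (fun b => glueLoad c₁ c₂ (e (Sum.inr b))) = c₂ := fun c₁ c₂ => by
    funext a; simp [glueLoad]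
  refine sum_nbij (fun q => (join e q.1.1.1 q.2.1 q.2.2.2, glueLoad q.1.1.2 q.2.2.1,
    e (Sum.inl q.1.2))) ?_ ?_ ?_ ?_
  · rintro ⟨⟨⟨g₁, c₁⟩, a₀⟩, g₂, c₂, b₀⟩ hq
    rw [mem_product, mem_product, mem_primeTrees, mem_markedPrimeTrees] at hq
    obtain ⟨⟨h₁, -⟩, h₂⟩ := hq
    dsimp only at h₁ h₂
    obtain ⟨h3, x, r, h4, h5⟩ := primeTree_join (e := e) (c := glueLoad c₁ c₂)
      (by rwa [hl]) (by rw [hr]; exact h₂) a₀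
    rw [mem_filter, mem_markedPrimeTrees]
    exact ⟨h3, x, r, h4, hA ▸ h5⟩
  · rintro ⟨⟨⟨g₁, c₁⟩, a₀⟩, g₂, c₂, b₀⟩ hq ⟨⟨⟨g₁', c₁'⟩, a₀'⟩, g₂', c₂', b₀'⟩ _ heq
    rw [mem_coe, mem_product, mem_product, mem_primeTrees] at hq
    obtain ⟨r, hr₁⟩ := card_eq_one.1 hq.1.1.2.1
    have hr₁ : g₁ r = none := by
      rw [← mem_roots]
      exact hr₁ ▸ mem_singleton_self r
    simp only [Prod.mk.injEq] at heq
    obtain ⟨h3, h4, h5⟩ := heq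
    obtain ⟨rfl, rfl, rfl⟩ := join_injective h3 hr₁
    have h6 := hl c₁ c₂
    have h7 := hr c₁ c₂
    rw [h4] at h6 h7
    rw [hl] at h6
    rw [hr] at h7
    obtain rfl := Sum.inl_injective (e.injective h5)
    rw [h6, h7]
  · rintro ⟨g, c, v₀⟩ hp
    simp only [coe_filter, Set.mem_ofPred_eq, mem_markedPrimeTrees] at hp
    obtain ⟨⟨hg, hr₁, -⟩, x, r, hx, hcut⟩ := hp
    rw [hA] at hcut
    obtain ⟨a₀, rfl⟩ := hcut.start_mem
    obtain ⟨g₁, g₂, b₀, rfl, h₁, h₂⟩ := exists_join hg hr₁ hx hcut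
    refine ⟨(((g₁, fun a => c (e (Sum.inl a))), a₀), g₂, fun b => c (e (Sum.inr b)), b₀), ?_, ?_⟩
    · rw [mem_coe, mem_product, mem_product, mem_primeTrees, mem_markedPrimeTrees]
      exact ⟨⟨h₁, mem_univ _⟩, h₂⟩
    · refine Prod.ext rfl (Prod.ext (funext fun v => ?_) rfl)
      obtain ⟨y, rfl⟩ := e.surjective v
      rcases y with a | b <;> simp [glueLoad]
  · rintro ⟨⟨⟨g₁, c₁⟩, a₀⟩, g₂, c₂, b₀⟩ _
    dsimp only
    rw [loadWeight, loadWeight, loadWeight, ← e.prod_comp, Fintype.prod_sum_type]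
    simp [glueLoad]

theorem card_mul_primeSum (hV : 2 ≤ Fintype.card V) :
    Fintype.card V * primeSum V = ∑ A : Finset V,
      (Fintype.card {v // v ∈ A} * primeSum {v // v ∈ A})
        * (Fintype.card {v // v ∉ A} * primeSum {v // v ∉ A}) := by
  classical
  rw [← sum_markedPrimeTrees]
  have h1 : ∀ p ∈ markedPrimeTrees V, loadWeight p.2.1
      = ∑ A : Finset V, if IsCutAlong p A then loadWeight p.2.1 else 0 := by
    intro p hp
    obtain ⟨hg, hr, x, hx⟩ := mem_markedPrimeTrees.1 hp
    obtain ⟨A, r, hA⟩ := exists_isCut hg hr hx hV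
    rw [sum_eq_single A.toFinset]
    · rw [if_pos ⟨x, r, hx, by rwa [Set.coe_toFinset]⟩]
    · rintro A' - hne
      refine if_neg ?_
      rintro ⟨x', r', hx', hA'⟩
      -- The flow is determined by the tree and its load, so both cuts refer to the same flow.
      obtain rfl := hx.unique hg hx'
      refine hne (Finset.coe_injective ?_)
      rw [Set.coe_toFinset]
      exact hA'.unique hg hA
    · intro h
      exact absurd (mem_univ _) h
  rw [sum_congr rfl h1, sum_comm]
  refine sum_congr rfl fun A _ => ?_
  rw [← sum_filter, sum_isCutAlong, sum_markedPrimeTrees]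

-- A tree with a prime flow is full and contributes to $u^0$ only; the single empty node accounts
-- for $u$.
omit [DecidableEq V] in
theorem loadPoly_primeForest {g : V → Option V} (hg : g ∈ trees V) :
    loadPoly (PrimeForest g) = Polynomial.C (∑ c ∈ loads (PrimeTree g), loadWeight c)
      + if Fintype.card V = 1 then Polynomial.X else 0 := by
  classical
  obtain ⟨hg, hr⟩ := mem_trees.1 hg
  have h1 : ∀ c, c ∈ loads (PrimeTree g) ↔ PrimeTree g c := fun c =>
    mem_loads fun c h => h.sum_eq.le
  have h2 : loads (PrimeForest g)
      = loads (PrimeTree g) ∪ if Fintype.card V = 1 then {0} else ∅ := by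
    ext c
    rw [mem_loads fun _ h => h.sum_le, mem_union, h1, primeForest_iff hg hr]
    split_ifs with h <;> simp [h]
  rw [loadPoly, h2, sum_union]
  · congr 1
    · rw [map_sum]
      refine sum_congr rfl fun c hc => ?_
      rw [((h1 c).1 hc).sum_eq, Nat.sub_self, Polynomial.monomial_zero_left]
    · split_ifs with h
      · simp [h, loadWeight, Polynomial.monomial_one_one_eq_X]
      · rfl
  · split_ifs with h
    · rw [disjoint_singleton_right, h1]
      intro h0
      have := h0.sum_eq
      simp [h] at this
    · exact disjoint_empty_right _

omit [DecidableEq V] in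
theorem primeSum_eq :
    primeSum V = ∑ g ∈ trees V, ∑ c ∈ loads (PrimeTree g), loadWeight c := by
  classical
  rw [primeSum, primeTrees, sum_filter, sum_product, trees, sum_filter]
  refine sum_congr rfl fun g _ => ?_
  split_ifs with h
  · rw [loads, sum_filter]
  · exact sum_eq_zero fun c _ => if_neg fun h' => h ⟨h'.1, h'.2.1⟩

omit [DecidableEq V] in
theorem trees_of_unique [Unique V] : trees V = {fun _ => none} := by
  ext g
  rw [mem_trees, mem_singleton]
  constructor
  · rintro ⟨hg, -⟩
    funext v
    cases hv : g v with
    | none => rfl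
    | some w => exact absurd (hv.trans (congrArg some (Subsingleton.elim w v))) hg.ne
  · rintro rfl
    refine ⟨fun Z hZ => Set.eq_empty_iff_forall_notMem.2 fun v hv => ?_, ?_⟩
    · obtain ⟨w, -, hw⟩ := hZ v hv
      exact absurd hw (by simp)
    · simp [roots]

omit [DecidableEq V] in
theorem totalConnected_eq_primeSum : totalConnected (forestWeight 1) V
    = Polynomial.C (primeSum V) + if Fintype.card V = 1 then Polynomial.X else 0 := by
  classical
  have h1 : totalConnected (forestWeight 1) V = ∑ g ∈ trees V, loadPoly (PrimeForest g) := by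
    rw [totalConnected, trees, sum_filter, sum_filter]
    refine sum_congr rfl fun g _ => ?_
    by_cases hg : Acyclic g
    · simp [hg, hg.isConnected_iff, forestWeight]
    · simp [hg, forestWeight, loadPoly_primeForest_of_not_acyclic hg]
  rw [h1, sum_congr rfl fun g hg => loadPoly_primeForest hg, sum_add_distrib, ← map_sum,
    ← primeSum_eq]
  congr 1
  split_ifs with h
  · obtain ⟨⟨v, hv⟩⟩ := Fintype.card_eq_one_iff_nonempty_unique.1 h
    have : Unique V := ⟨v, hv⟩
    rw [trees_of_unique, sum_singleton]
  · exact sum_const_zero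

-- Relabelling invariance is inherited from `totalConnected`, by cancelling the common term in $u$.
omit [DecidableEq V] in
theorem primeSum_eq_card : primeSum V = primeSum (Fin (Fintype.card V)) := by
  have h1 := totalConnected_eq_card (isMultiplicative_forestWeight 1) V
  rw [totalConnected_eq_primeSum, totalConnected_eq_primeSum, Fintype.card_fin] at h1
  exact Polynomial.C_injective (add_right_cancel h1)

omit [DecidableEq V] in
theorem primeSum_of_unique [Unique V] : primeSum V = 1 := by
  rw [primeSum_eq, trees_of_unique, sum_singleton]
  have h1 : loads (PrimeTree fun _ : V => none) = {fun _ => 1} := by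
    ext c
    rw [mem_loads fun _ h => h.sum_eq.le, mem_singleton]
    constructor
    · intro h
      have := h.sum_eq
      rw [Fintype.sum_unique, Fintype.card_unique] at this
      funext v
      rw [Subsingleton.elim v default, this]
    · rintro rfl
      have h2 : (fun _ => none) ∈ trees V := by
        rw [trees_of_unique, mem_singleton]
      exact ⟨(mem_trees.1 h2).1, (mem_trees.1 h2).2, 0, by simp, by simp [inflow]⟩
  rw [h1, sum_singleton]
  simp [loadWeight]

end Sums

/-! ### The quadratic equation for pointed prime trees -/

section GeneratingFunctions

open ParkingSeries

theorem card_mul_primeSum_fin (n : ℕ) : (n : ℚ) * primeSum (Fin n)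
    = (if n = 1 then 1 else 0) + ∑ A : Finset (Fin n), ((A.card : ℚ) * primeSum (Fin A.card))
        * (((n - A.card : ℕ) : ℚ) * primeSum (Fin (n - A.card))) := by
  rcases lt_or_ge n 2 with hn | hn
  · have h1 : ∀ A : Finset (Fin n), ((A.card : ℚ) * primeSum (Fin A.card))
        * (((n - A.card : ℕ) : ℚ) * primeSum (Fin (n - A.card))) = 0 := by
      intro A
      have h2 := card_le_univ A
      rw [Fintype.card_fin] at h2
      rcases Nat.eq_zero_or_pos A.card with h3 | h3
      · simp [h3]
      · have h4 : n - A.card = 0 := by omega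
        simp [h4]
    rw [sum_eq_zero fun A _ => h1 A, add_zero]
    interval_cases n
    · simp
    · rw [primeSum_of_unique]
      simp
  · have h1 := card_mul_primeSum (V := Fin n) (by rwa [Fintype.card_fin])
    rw [Fintype.card_fin] at h1
    rw [if_neg (by omega), zero_add, h1]
    refine sum_congr rfl fun A _ => ?_
    have h2 : Fintype.card {x // x ∈ A} = A.card := Fintype.card_coe A
    have h3 : Fintype.card {x // x ∉ A} = n - A.card := by
      rw [Fintype.card_subtype_compl, Fintype.card_fin, Fintype.card_coe]
    rw [primeSum_eq_card (V := {x // x ∈ A}), primeSum_eq_card (V := {x // x ∉ A}), h2, h3]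

/-- The generating function of prime trees with a marked node. -/
noncomputable def pointedPrimeGF : Series :=
  egf fun n => Polynomial.C ((n : ℚ) * primeSum (Fin n))

theorem zVar_dvd_pointedPrimeGF : zVar ∣ pointedPrimeGF := zVar_dvd_egf (by simp)

theorem egf_add (φ ψ : ℕ → Polynomial ℚ) : egf (fun n => φ n + ψ n) = egf φ + egf ψ := by
  ext d
  rw [map_add, coeff_egf, coeff_egf, coeff_egf, Polynomial.coeff_add, add_div]

theorem egf_ite_eq_one (f : Polynomial ℚ) (d : Fin 2 →₀ ℕ) :
    MvPowerSeries.coeff d (egf fun n => if n = 1 then f else 0)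
      = if d 0 = 1 then f.coeff (d 1) else 0 := by
  rw [coeff_egf]
  split_ifs with h <;> simp [h]

theorem egf_one_eq_zVar : egf (fun n => if n = 1 then 1 else 0) = zVar := by
  classical
  ext d
  rw [egf_ite_eq_one, zVar, MvPowerSeries.coeff_X, Polynomial.coeff_one, ← ite_and]
  refine if_congr ?_ rfl rfl
  constructor
  · rintro ⟨h1, h2⟩
    ext i
    fin_cases i
    · simpa using h1
    · simpa using h2
  · rintro rfl
    simp

theorem egf_X_eq : egf (fun n => if n = 1 then Polynomial.X else 0) = uVar * zVar := by
  classical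
  ext d
  rw [egf_ite_eq_one, uVar, zVar, MvPowerSeries.X, MvPowerSeries.X,
    MvPowerSeries.monomial_mul_monomial, MvPowerSeries.coeff_monomial, Polynomial.coeff_X,
    ← ite_and, one_mul]
  refine if_congr ?_ rfl rfl
  constructor
  · rintro ⟨h1, h2⟩
    ext i
    fin_cases i
    · simpa using h1
    · simpa using h2.symm
  · rintro rfl
    simp

theorem pointedPrimeGF_eq : pointedPrimeGF = zVar + pointedPrimeGF ^ 2 := by
  rw [pow_two, pointedPrimeGF, ← egf_one_eq_zVar, ← egf_eq_mul fun n => rfl, ← egf_add]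
  congr 1
  funext n
  rw [card_mul_primeSum_fin n, map_add, map_sum]
  congr 1
  · split_ifs <;> simp
  · exact sum_congr rfl fun A _ => by rw [map_mul]

theorem theta_primeGF : theta primeGF = uVar * zVar + pointedPrimeGF := by
  rw [primeGF, theta_egf, pointedPrimeGF, ← egf_X_eq, ← egf_add]
  congr 1
  funext n
  rw [totalConnected_eq_primeSum, Fintype.card_fin, mul_add, map_mul, map_natCast, add_comm]
  congr 1
  split_ifs with h <;> simp [h]

end GeneratingFunctions

end RoadNet

theorem mainTheorem8 :
    ∃ Q : Series,
      -- `Q` is the unique power series with zero constant term solving the functional equation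
      (Q.constantCoeff = 0 ∧ Q = zVar * expSeries (Q * (2 + uVar * (1 - Q)))) ∧
      (∀ P : Series, P.constantCoeff = 0 →
        P = zVar * expSeries (P * (2 + uVar * (1 - P))) → P = Q) ∧
      -- trees
      treeGF = Q * (2 + uVar * (1 - Q)) + lnSeries (1 - Q) ∧
      (∃ R : Series, zVar * R = Q * (1 - Q) ∧ R.constantCoeff = 1 ∧ treeGF = lnSeries R) ∧
      -- connected mappings
      connectedGF = lnSeries (((1 - Q) * (1 - uVar * Q))⁻¹) ∧
      -- mappings
      mappingGF = ((1 - Q) * (1 - uVar * Q))⁻¹ := by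
  open RoadNet ParkingSeries in
  refine closed_forms (zVar_dvd_egf (totalConnected_of_isEmpty _)) theta_primeGF
    pointedPrimeGF_eq zVar_dvd_pointedPrimeGF theta_forestGF zVar_dvd_forestGF_sub_one
    mappingGF_eq_diagonalTransform ?_ theta_treeGF ?_ theta_mappingGF
  · rw [treeGF_eq]
    refine zVar_dvd_egf (Finset.sum_eq_zero fun h hh => ?_)
    obtain ⟨T, -⟩ := mem_trees_iff_exists_cayleyTree.1 hh
    exact T.root.elim0
  · rw [connectedGF_eq]
    exact zVar_dvd_egf (totalConnected_of_isEmpty _)
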